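/- Let $n\ge 2$, let $R\ge \tfrac12$, and let $g:(0,R)\to\mathbb R$ be a bounded measurable function with $g(r)>-1+\varepsilon_0$ on $(0,R)$ for some $\varepsilon_0>0$. Consider in the ball $B_R=\{|x|<R\}\subset\mathbb R^n$ the uniformly elliptic equation $$\partial_j\bigl(a_{ij}(x)\,\partial_i u\bigr)=0,\qquad a_{ij}(x)=\delta_{ij}+g(r)\,\theta_i\theta_j,\quad r=|x|,\ \theta=x/|x|. \qquad (1)$$ Assume that $g$ has finite total variation on $(0,\tfrac12)$, that $$\limsup_{r\to0^+}\int_r^{1/2}\frac{g(\rho)}{\rho}\,d\rho=+\infty ,$$ and that $g$ is square-Dini continuous at $0$, i.e. there is a continuous nondecreasing function $\omega:[0,\infty)\to[0,\infty)$ with $\omega(0)=0$, $\int_0^{1/2}\omega(r)^2\,\frac{dr}{r}<\infty$ and $|g(r)|\le\omega(r)$ for all sufficiently small $r>0$. Then there exists a weak solution $u\in H^{1,2}(B_R)$ of (1), continuous in $B_R$ and of the form $u=v(r)\,\Theta_1(\theta)$, where $v(0)=0$ and $\Theta_1$ is an eigenfunction of the Laplace–Beltrami operator $-\Delta_\theta$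 on the unit sphere $S^{n-1}$ for its first nonzero eigenvalue $n-1$, such that $u$ is not Lipschitz continuous at $x=0$: there are no $c,\delta>0$ with $|u(x)-u(0)|\le c\,|x|$ for all $|x|<\delta$. If $g(r)>0$ for all $r\in(0,\varepsilon)$ for some $\varepsilon>0$, then the same conclusion holds without assuming that $g$ is square-Dini continuous at $0$. -/

import Mathlib

open Set Filter Topology MeasureTheory
open scoped ContDiff

noncomputable section

/-- Euclidean space `ℝⁿ`. -/
abbrev Eu (n : ℕ) : Type := EuclideanSpace ℝ (Fin n)

/-- The Gilbarg-Serrin coefficients `a_{ij}(x) = δ_{ij} + g(r) θ_i θ_j`, with `r = |x|` and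
`θ = x / |x|` (for `x ≠ 0`; the single point `x = 0` gets the identity matrix). -/
def gsCoeff {n : ℕ} (g : ℝ → ℝ) (x : Eu n) : Matrix (Fin n) (Fin n) ℝ :=
  fun i j => (if i = j then 1 else 0) + g ‖x‖ * (x i / ‖x‖) * (x j / ‖x‖)

/-- `φ ∈ C_c^∞(Ω)`, as a function on all of `ℝⁿ`. -/
def IsTestFunction {n : ℕ} (Ω : Set (Eu n)) (φ : Eu n → ℝ) : Prop :=
  ContDiff ℝ ∞ φ ∧ HasCompactSupport φ ∧ tsupport φ ⊆ Ω

/-- The classical partial derivative `∂_i φ (x)`. -/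
def pderiv {n : ℕ} (i : Fin n) (φ : Eu n → ℝ) (x : Eu n) : ℝ :=
  fderiv ℝ φ x (EuclideanSpace.single i 1)

/-- `u ∈ H^{1,2}(Ω)` and `G = ∇u` in the weak sense: `u` and `G` are in `L²(Ω)`, and
`∫_Ω u ∂_i φ = - ∫_Ω G_i φ` for all `φ ∈ C_c^∞(Ω)` and all `i`. -/
def IsH1WithGradient {n : ℕ} (Ω : Set (Eu n)) (u : Eu n → ℝ) (G : Eu n → Eu n) : Prop :=
  MemLp u 2 (volume.restrict Ω) ∧ MemLp G 2 (volume.restrict Ω) ∧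
    ∀ φ : Eu n → ℝ, IsTestFunction Ω φ → ∀ i : Fin n,
      ∫ x in Ω, u x * pderiv i φ x = - ∫ x in Ω, G x i * φ x

/-- `u ∈ H^{1,2}(Ω)` is a weak solution of `∂_j (a_{ij} ∂_i u) = 0` in `Ω`, for bounded measurable
coefficients `a`: `∫_Ω a_{ij} ∂_i u ∂_j φ = 0` for all `φ ∈ C_c^∞(Ω)`. -/
def IsWeakSolution {n : ℕ} (a : Eu n → Matrix (Fin n) (Fin n) ℝ) (Ω : Set (Eu n))
    (u : Eu n → ℝ) : Prop :=
  ∃ G : Eu n → Eu n, IsH1WithGradient Ω u G ∧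
    ∀ φ : Eu n → ℝ, IsTestFunction Ω φ →
      ∫ x in Ω, ∑ i, ∑ j, a x i j * G x i * pderiv j φ x = 0

/-- `u` is Lipschitz continuous at `x = 0`: `|u(x) - u(0)| ≤ c |x|` on some small ball. -/
def LipschitzAtZero {n : ℕ} (u : Eu n → ℝ) : Prop :=
  ∃ c > 0, ∃ δ > 0, ∀ x ∈ Metric.ball (0 : Eu n) δ, |u x - u 0| ≤ c * ‖x‖

/-- `g` is square-Dini continuous at `0`: `|g(r)| ≤ w(r)` as `r → 0⁺`, for a continuous
nondecreasing `w : [0,∞) → [0,∞)` with `w(0) = 0` and `∫_0^{1/2} w(r)² / r dr < ∞`. (For the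
Gilbarg-Serrin coefficients, `max_{i,j} sup_{|x| = r} |a_{ij}(x) - δ_{ij}| = |g(r)|`.) -/
def SquareDiniAtZero (g : ℝ → ℝ) : Prop :=
  ∃ w : ℝ → ℝ, ContinuousOn w (Ici 0) ∧ MonotoneOn w (Ici 0) ∧ w 0 = 0 ∧
    IntegrableOn (fun r => w r ^ 2 / r) (Ioo 0 (1 / 2)) ∧
    ∀ᶠ r in 𝓝[>] (0 : ℝ), |g r| ≤ w r

/-- The extension of a function on the unit sphere to `ℝⁿ \ {0}` that is constant along rays. -/
def radialExt {n : ℕ} (Θ : Eu n → ℝ) (x : Eu n) : ℝ := Θ (‖x‖⁻¹ • x)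

/-- `Θ` (only its values on the unit sphere matter) is an eigenfunction of the Laplace-Beltrami
operator of the unit sphere `S^{n-1}` for the eigenvalue `lam`, i.e. `Θ` is smooth, not identically
zero, and `-Δ_θ Θ = lam Θ`. On the sphere, `Δ_θ Θ` is the Euclidean Laplacian of the extension
of `Θ` that is constant along rays. -/
def IsSphereEigenfunction {n : ℕ} (lam : ℝ) (Θ : Eu n → ℝ) : Prop :=
  ContDiffOn ℝ ∞ (radialExt Θ) {0}ᶜ ∧
    (∃ θ ∈ Metric.sphere (0 : Eu n) 1, Θ θ ≠ 0) ∧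
    ∀ θ ∈ Metric.sphere (0 : Eu n) 1, - Laplacian.laplacian (radialExt Θ) θ = lam * Θ θ

end

/-! For `u = v(r) θ_i` equation (1) becomes `((1+g) r^{n-1} v')' = (n-1) r^{n-3} v`. With `a =
1/(1+g)`, the unknown `q = (1+g) r v'/v` satisfies the Riccati equation `r q' = κ - (κ-1) q - a q²`,
`κ = n-1`. Since `q` carries the flux rather than `v'`, it is locally Lipschitz even where `g`
jumps. A solution trapped between positive constants is built by monotone iteration
(`exists_riccati_solution`), and `r v' = a q v` then determines `k = v/r` through `log k(r) = ∫_1^r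
(a q - 1)/ρ dρ`.

The growth of `k` comes from completing a square: `(κ+1)(1 - a q)/ρ = a q' + κ(1-a)/ρ + (1 - a
q)²/ρ`. Integrate over `(r, 1/2)` and drop the square. The term `∫ a q'` stays bounded because `a`
has bounded variation and `q` is bounded (`BoundedVariationOn.exists_abs_integral_mul_le`). Also `1
- a = g/(1+g)` dominates a positive multiple of `g`, up to an error that is integrable against
`dρ/ρ`: the error is `g²/(1+g)` under square-Dini continuity, and there is none near `0` when `g >
0` (`exists_comparison`). Hence `log k` is unbounded above along with `∫_r^{1/2} g/ρ`, which
excludes a Lipschitz bound at `0` (`frequently_lt_integral_profile`).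

The lower bound `a q ≥ β > 0` gives `k ≤ C r^{β-1}`. This yields continuity and finite energy, and
makes the origin removable in the weak formulation (`isWeakSolution_radial`). -/

/-! ### Second mean value theorem and functions of bounded variation. -/

/-- Over the part of `(a, b]` where a monotone function exceeds a threshold, one integrates over a
terminal interval. -/
lemma exists_setIntegral_superlevel_eq {f h : ℝ → ℝ} {a b : ℝ} (hab : a ≤ b) (hf : Monotone f)
    (τ : ℝ) :
    ∃ c ∈ Icc a b, ∫ x in Ioc a b, {x | τ < f x}.indicator h x = ∫ x in c..b, h x := by
  -- Adjoining `b` keeps the set nonempty: an empty superlevel set then gives `c = b` and both sides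
  -- vanish.
  set S : Set ℝ := {x | x ∈ Icc a b ∧ (τ < f x ∨ x = b)} with hS
  have hbS : b ∈ S := ⟨⟨hab, le_rfl⟩, Or.inr rfl⟩
  have hbdd : BddBelow S := ⟨a, fun x hx => hx.1.1⟩
  have hac : a ≤ sInf S := le_csInf ⟨b, hbS⟩ fun x hx => hx.1.1
  have hcb : sInf S ≤ b := csInf_le hbdd hbS
  refine ⟨sInf S, ⟨hac, hcb⟩, ?_⟩
  rw [intervalIntegral.integral_of_le hcb, ← integral_indicator measurableSet_Ioc,
    ← integral_indicator measurableSet_Ioc]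
  apply integral_congr_ae
  have h1 : ∀ᵐ x : ℝ, x ≠ sInf S := by simp [ae_iff, measure_singleton]
  have h2 : ∀ᵐ x : ℝ, x ≠ b := by simp [ae_iff, measure_singleton]
  filter_upwards [h1, h2] with x hx hxb
  by_cases hxab : x ∈ Ioc a b
  · rw [indicator_of_mem hxab]
    rcases lt_or_gt_of_ne hx with hlt | hgt
    · have : ¬ τ < f x := fun h =>
        not_le.2 hlt (csInf_le hbdd (show x ∈ S from ⟨Ioc_subset_Icc_self hxab, Or.inl h⟩))
      rw [indicator_of_notMem (by simpa using this), indicator_of_notMem]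
      exact fun h => not_lt.2 hlt.le h.1
    · obtain ⟨s, hs, hsx⟩ := exists_lt_of_csInf_lt ⟨b, hbS⟩ hgt
      have hτ : τ < f x := by
        rcases hs.2 with h | h
        · exact h.trans_le (hf hsx.le)
        · exact absurd hxab.2 (not_le.2 (h ▸ hsx))
      rw [indicator_of_mem (show x ∈ {x | τ < f x} from hτ), indicator_of_mem (show x ∈ Ioc (sInf S) b from ⟨hgt, hxab.2⟩)]
  · rw [indicator_of_notMem hxab, indicator_of_notMem]
    exact fun h => hxab ⟨hac.trans_lt h.1, h.2⟩

/-- A form of the second mean value theorem: if all terminal integrals of `h` are bounded by `K`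
and `f` is monotone with values in `[0, A]`, then `|∫ f h| ≤ A K`. -/
lemma abs_integral_mul_le_of_monotone {f h : ℝ → ℝ} {a b A K : ℝ} (hab : a ≤ b)
    (hf : Monotone f) (hf0 : ∀ x, 0 ≤ f x) (hfA : ∀ x, f x ≤ A)
    (hh : IntervalIntegrable h volume a b)
    (hK : ∀ c ∈ Icc a b, |∫ x in c..b, h x| ≤ K) :
    |∫ x in a..b, f x * h x| ≤ A * K := by
  have hA : 0 ≤ A := (hf0 0).trans (hfA 0)
  have hh' : IntegrableOn h (Ioc a b) := (intervalIntegrable_iff_integrableOn_Ioc_of_le hab).1 hh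
  have hmeas : MeasurableSet {p : ℝ × ℝ | p.2 < f p.1} :=
    measurableSet_lt measurable_snd (hf.measurable.comp measurable_fst)
  -- Layer-cake formula for `f`. After Fubini, each level `τ` contributes a terminal integral of
  -- `h`, and the levels fill an interval of length `A`.
  have key : ∀ x, f x * h x = ∫ τ in Ioc 0 A, {x | τ < f x}.indicator h x := by
    intro x
    have : ∀ τ, {x | τ < f x}.indicator h x = (Iio (f x)).indicator (fun _ => h x) τ := by
      intro τ
      by_cases hτ : τ < f x <;> simp [indicator, hτ]
    simp_rw [this]
    rw [setIntegral_indicator measurableSet_Iio, setIntegral_const]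
    have : (volume.real (Ioc 0 A ∩ Iio (f x))) = f x := by
      have h1 : Ioc 0 A ∩ Iio (f x) = Ioo 0 (f x) := by
        ext τ
        simp only [mem_inter_iff, mem_Ioc, mem_Iio, mem_Ioo]
        exact ⟨fun h => ⟨h.1.1, h.2⟩, fun h => ⟨⟨h.1, h.2.le.trans (hfA x)⟩, h.2⟩⟩
      rw [h1, Real.volume_real_Ioo_of_le (hf0 x), sub_zero]
    rw [this, smul_eq_mul]
  rw [intervalIntegral.integral_of_le hab]
  simp_rw [key]
  rw [integral_integral_swap]
  · have : ∀ τ ∈ Ioc 0 A, ‖∫ x in Ioc a b, {x | τ < f x}.indicator h x‖ ≤ K := by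
      intro τ _
      obtain ⟨c, hc, hce⟩ := exists_setIntegral_superlevel_eq (h := h) hab hf τ
      rw [hce]
      exact hK c hc
    have := norm_setIntegral_le_of_norm_le_const (μ := volume) (s := Ioc 0 A)
      measure_Ioc_lt_top this
    rw [Real.volume_real_Ioc_of_le hA, sub_zero] at this
    rw [mul_comm A K]
    exact this
  · have hb : Integrable (fun p : ℝ × ℝ => h p.1)
        ((volume.restrict (Ioc a b)).prod (volume.restrict (Ioc 0 A))) := hh'.comp_fst _
    have := hb.indicator hmeas
    refine this.congr (Eventually.of_forall ?_)
    rintro ⟨x, τ⟩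
    simp [indicator, Function.uncurry]

lemma abs_integral_mul_le_of_monotoneOn {f h : ℝ → ℝ} {s : Set ℝ} {a b A K : ℝ} (hab : a ≤ b)
    (hs : Ioo a b ⊆ s) (hf : MonotoneOn f s) (hf0 : ∀ x ∈ s, 0 ≤ f x) (hfA : ∀ x ∈ s, f x ≤ A)
    (hA : 0 ≤ A) (hh : IntervalIntegrable h volume a b)
    (hK : ∀ c ∈ Icc a b, |∫ x in c..b, h x| ≤ K) :
    |∫ x in a..b, f x * h x| ≤ A * K := by
  -- The monotone extension may leave `[0, A]` outside `s`, so it is clamped. This changes nothing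
  -- on `s`, and the endpoint `b` is negligible.
  obtain ⟨F, hF, hFf⟩ := hf.exists_monotone_extension
    ⟨0, by rintro _ ⟨x, hx, rfl⟩; exact hf0 x hx⟩ ⟨A, by rintro _ ⟨x, hx, rfl⟩; exact hfA x hx⟩
  have := abs_integral_mul_le_of_monotone (f := fun x => max 0 (min A (F x))) (A := A) hab
    (fun x y hxy => max_le_max le_rfl (min_le_min le_rfl (hF hxy)))
    (fun x => le_max_left _ _) (fun x => max_le hA (min_le_left _ _)) hh hK
  convert this using 2
  apply intervalIntegral.integral_congr_ae
  have h2 : ∀ᵐ x : ℝ, x ≠ b := by simp [ae_iff, measure_singleton]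
  filter_upwards [h2] with x hxb hx
  rw [uIoc_of_le hab] at hx
  have hxs : x ∈ s := hs ⟨hx.1, lt_of_le_of_ne hx.2 hxb⟩
  rw [← hFf hxs, min_eq_right (hfA x hxs), max_eq_right (hf0 x hxs)]

/-- Integration against a function of bounded variation: the bound only depends on the terminal
integrals of `h`. -/
lemma BoundedVariationOn.exists_abs_integral_mul_le {f : ℝ → ℝ} {α β : ℝ}
    (hf : BoundedVariationOn f (Ioo α β)) :
    ∃ C : ℝ, ∀ (h : ℝ → ℝ) (r K : ℝ), r ∈ Ioo α β → IntervalIntegrable h volume r β →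
      (∀ c ∈ Icc r β, |∫ x in c..β, h x| ≤ K) → |∫ x in r..β, f x * h x| ≤ C * K := by
  rcases (Ioo α β).eq_empty_or_nonempty with he | ⟨c, hc⟩
  · exact ⟨0, fun h r K hr => by simp [he] at hr⟩
  have hloc := hf.locallyBoundedVariationOn
  set V := (eVariationOn f (Ioo α β)).toReal with hV
  set p : ℝ → ℝ := fun x => variationOnFromTo f (Ioo α β) c x with hp
  have hV0 : 0 ≤ V := ENNReal.toReal_nonneg
  have hpV : ∀ x, |p x| ≤ V := fun x => variationOnFromTo.abs_le_eVariationOn hf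
  have hfc : ∀ x ∈ Ioo α β, |f x| ≤ |f c| + V := by
    intro x hx
    have h1 : |f x - f c| ≤ V := by
      have := ENNReal.toReal_mono hf (eVariationOn.edist_le f hx hc)
      rwa [edist_dist, ENNReal.toReal_ofReal dist_nonneg, Real.dist_eq] at this
    calc |f x| = |f x - f c + f c| := by ring_nf
      _ ≤ |f x - f c| + |f c| := abs_add_le _ _
      _ ≤ _ := by linarith
  have hpm : MonotoneOn p (Ioo α β) := variationOnFromTo.monotoneOn hloc hc
  have hqm : MonotoneOn (fun x => p x - f x) (Ioo α β) :=
    variationOnFromTo.sub_self_monotoneOn hloc hc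
  set B := |f c| + V + V with hB
  have hB0 : 0 ≤ B := by positivity
  -- Jordan decomposition `f = (p + V) - (p - f + B) + (B - V)`, with the shifts making both
  -- monotone parts nonnegative. The three terms cost `2V`, `2B` and `B + V` times `K`.
  refine ⟨4 * V + 4 * B, fun h r K hr hh hK => ?_⟩
  have hK0 : 0 ≤ K := (abs_nonneg _).trans (hK r ⟨le_rfl, hr.2.le⟩)
  have hsub : Ioo r β ⊆ Ioo α β := Ioo_subset_Ioo_left hr.1.le
  have e1 := abs_integral_mul_le_of_monotoneOn (f := fun x => p x + V) (A := 2 * V) hr.2.le hsub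
    (fun x hx y hy hxy => by have := hpm hx hy hxy; simpa using this)
    (fun x _ => by have := abs_le.1 (hpV x); linarith)
    (fun x _ => by have := abs_le.1 (hpV x); linarith) (by positivity) hh hK
  have e2 := abs_integral_mul_le_of_monotoneOn (f := fun x => p x - f x + B) (A := 2 * B) hr.2.le
    hsub (fun x hx y hy hxy => by have := hqm hx hy hxy; simpa using this)
    (fun x hx => by have := abs_le.1 (hpV x); have := abs_le.1 (hfc x hx); linarith)
    (fun x hx => by have := abs_le.1 (hpV x); have := abs_le.1 (hfc x hx); linarith)
    (by positivity) hh hK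
  have e3 := hK r ⟨le_rfl, hr.2.le⟩
  have hbm : ∀ G : ℝ → ℝ, MonotoneOn G (Ioo α β) → ∀ A : ℝ, (∀ x ∈ Ioo α β, |G x| ≤ A) →
      IntervalIntegrable (fun x => G x * h x) volume r β := by
    intro G hG A hGA
    rw [intervalIntegrable_iff_integrableOn_Ioo_of_le hr.2.le] at hh ⊢
    refine Integrable.bdd_mul (c := A) hh ?_ ?_
    · exact (aemeasurable_restrict_of_monotoneOn measurableSet_Ioo
        (hG.mono hsub)).aestronglyMeasurable
    · filter_upwards [ae_restrict_mem measurableSet_Ioo] with x hx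
      exact hGA x (hsub hx)
  have i1 := hbm (fun x => p x + V) (fun x hx y hy hxy => by simpa using hpm hx hy hxy) (2 * V)
    (fun x _ => by have := abs_le.1 (hpV x); rw [abs_le]; constructor <;> linarith)
  have i2 := hbm (fun x => p x - f x + B) (fun x hx y hy hxy => by simpa using hqm hx hy hxy)
    (2 * B) (fun x hx => by
      have := abs_le.1 (hpV x); have := abs_le.1 (hfc x hx); rw [abs_le]; constructor <;> linarith)
  have split : ∫ x in r..β, f x * h x = (∫ x in r..β, (p x + V) * h x)
      - (∫ x in r..β, (p x - f x + B) * h x) + (B - V) * ∫ x in r..β, h x := by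
    rw [← intervalIntegral.integral_sub i1 i2, ← intervalIntegral.integral_const_mul,
      ← intervalIntegral.integral_add (i1.sub i2) (hh.const_mul _)]
    apply intervalIntegral.integral_congr
    intro x _
    simp only
    ring
  rw [split]
  have hBV : |B - V| ≤ B + V := by rw [abs_le]; constructor <;> linarith
  have e4 : |(B - V) * ∫ x in r..β, h x| ≤ (B + V) * K := by
    rw [abs_mul]; exact mul_le_mul hBV e3 (abs_nonneg _) (by positivity)
  calc _ ≤ |(∫ x in r..β, (p x + V) * h x)| + |(∫ x in r..β, (p x - f x + B) * h x)|
        + |(B - V) * ∫ x in r..β, h x| :=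
        (abs_add_le _ _).trans (add_le_add (abs_sub _ _) le_rfl)
    _ ≤ 2 * V * K + 2 * B * K + (B + V) * K := by linarith
    _ ≤ _ := by nlinarith [mul_nonneg hV0 hK0, mul_nonneg hB0 hK0]

/-! ### The Riccati equation with measurable coefficient. -/

/-- A positive bounded measurable solution `q` on `(0, ∞)` of the Riccati equation
`r q' = κ - (κ - 1) q - a q²` with merely measurable coefficient `a`, in integrated form. -/
lemma exists_riccati_solution {κ a₀ a₁ : ℝ} (hκ : 1 ≤ κ) (ha₀ : 0 < a₀) {a : ℝ → ℝ}
    (ha : Measurable a) (hal : ∀ r, a₀ ≤ a r) (hau : ∀ r, a r ≤ a₁) :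
    ∃ (q : ℝ → ℝ) (N : ℕ) (m M : ℝ), 0 < m ∧ Measurable q ∧ (∀ r, m ≤ q r) ∧ (∀ r, q r ≤ M) ∧
      ∀ r, 0 < r → q r * r ^ (N + 1) =
        ∫ ρ in (0 : ℝ)..r, ρ ^ N * (κ + (N + 2 - κ) * q ρ - a ρ * q ρ ^ 2) := by
  have ha₁ : 0 < a₁ := ha₀.trans_le ((hal 0).trans (hau 0))
  -- The constants `m` and `M` are a sub- and a supersolution: `κ - (κ-1)x - a x²` is nonnegative at
  -- `m` and nonpositive at `M`.
  set m : ℝ := 1 / (1 + a₁) with hm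
  set M : ℝ := 1 + κ / a₀ with hM
  have hm0 : 0 < m := by positivity
  have hm1 : m ≤ 1 := by rw [hm, div_le_one (by positivity)]; linarith
  have hM1 : 1 ≤ M := by have : 0 ≤ κ / a₀ := by positivity
                         linarith
  have hmM : m ≤ M := hm1.trans hM1
  -- The integrating factor `r^{N+1}` turns the equation into `(r^{N+1} q)' = r^N F(r, q)`. For `N`
  -- this large, `∂F/∂x = N + 2 - κ - 2 a x ≥ 0` on `[m, M]`, so the integral operator is order
  -- preserving.
  obtain ⟨N, hN⟩ := exists_nat_ge (κ + 2 * a₁ * M)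
  set F : ℝ → ℝ → ℝ := fun ρ x => κ + (N + 2 - κ) * x - a ρ * x ^ 2 with hF
  have hFmono : ∀ ρ x y, m ≤ x → x ≤ y → y ≤ M → F ρ x ≤ F ρ y := by
    intro ρ x y hx hxy hy
    have h1 : F ρ y - F ρ x = (y - x) * ((N + 2 - κ) - a ρ * (x + y)) := by simp only [hF]; ring
    have h2 : a ρ * (x + y) ≤ a₁ * (2 * M) :=
      mul_le_mul (hau ρ) (by linarith) (by linarith) ha₁.le
    have h3 : 0 ≤ (y - x) * ((N + 2 - κ) - a ρ * (x + y)) :=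
      mul_nonneg (by linarith) (by linarith)
    linarith
  have hFm : ∀ ρ, (N + 1) * m ≤ F ρ m := by
    intro ρ
    have h1 : a₁ * m ≤ 1 := by
      rw [hm, mul_one_div, div_le_one (by positivity)]; linarith
    have h2 : a ρ * m ^ 2 ≤ 1 := by
      calc a ρ * m ^ 2 ≤ a₁ * m ^ 2 := by gcongr; exact hau ρ
        _ = (a₁ * m) * m := by ring
        _ ≤ 1 * 1 := mul_le_mul h1 hm1 hm0.le zero_le_one
        _ = 1 := one_mul 1
    have h3 : (κ - 1) * m ≤ (κ - 1) * 1 := mul_le_mul_of_nonneg_left hm1 (by linarith)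
    simp only [hF]
    linarith
  have hFM : ∀ ρ, F ρ M ≤ (N + 1) * M := by
    intro ρ
    have h1 : κ ≤ a₀ * M := by
      rw [hM, mul_add, mul_div_cancel₀ _ ha₀.ne']; linarith
    have h2 : κ ≤ a ρ * M ^ 2 := by
      calc κ ≤ a₀ * M := h1
        _ ≤ a₀ * M * M := le_mul_of_one_le_right (by positivity) hM1
        _ = a₀ * M ^ 2 := by ring
        _ ≤ a ρ * M ^ 2 := by gcongr; exact hal ρ
    have h3 : 0 ≤ (κ - 1) * M := mul_nonneg (by linarith) (by linarith)
    simp only [hF]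
    linarith
  have hFb : ∀ ρ x, m ≤ x → x ≤ M → |F ρ x| ≤ (N + 1) * M := by
    intro ρ x hx hxM
    rw [abs_le]
    have h1 := (hFm ρ).trans (hFmono ρ m x le_rfl hx hxM)
    have h2 := (hFmono ρ x M hx hxM le_rfl).trans (hFM ρ)
    have h3 : 0 ≤ (N + 1) * m := by positivity
    have h4 : 0 ≤ (N + 1) * M := by positivity
    constructor <;> linarith
  set P : (ℝ → ℝ) → Prop := fun q => Measurable q ∧ (∀ r, m ≤ q r) ∧ ∀ r, q r ≤ M with hP
  have hFmeas : ∀ q, P q → Measurable (fun ρ => ρ ^ N * F ρ (q ρ)) := by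
    intro q hq
    have := hq.1
    simp only [hF]
    fun_prop
  have hint : ∀ q, P q → ∀ x y, IntervalIntegrable (fun ρ => ρ ^ N * F ρ (q ρ)) volume x y := by
    intro q hq x y
    have h1 : IntervalIntegrable (fun ρ : ℝ => ρ ^ N * ((N + 1) * M)) volume x y :=
      Continuous.intervalIntegrable (by fun_prop) x y
    refine h1.mono_fun (hFmeas q hq).aestronglyMeasurable (Eventually.of_forall fun ρ => ?_)
    simp only [norm_mul, Real.norm_eq_abs]
    gcongr
    exact (hFb ρ _ (hq.2.1 ρ) (hq.2.2 ρ)).trans (by rw [← abs_mul]; exact le_abs_self _)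
  set T : (ℝ → ℝ) → ℝ → ℝ := fun q r =>
    if 0 < r then (∫ ρ in (0 : ℝ)..r, ρ ^ N * F ρ (q ρ)) / r ^ (N + 1) else m with hT
  have hpow : ∀ r : ℝ, ∀ c : ℝ, ∫ ρ in (0 : ℝ)..r, ρ ^ N * ((N + 1) * c) = c * r ^ (N + 1) := by
    intro r c
    rw [intervalIntegral.integral_mul_const, integral_pow]
    field_simp
    simp
  have hpowi : ∀ r : ℝ, ∀ c : ℝ, IntervalIntegrable (fun ρ : ℝ => ρ ^ N * ((N + 1) * c))
      volume 0 r := fun r c => Continuous.intervalIntegrable (by fun_prop) _ _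
  have hTP : ∀ q, P q → P (T q) := by
    intro q hq
    refine ⟨?_, fun r => ?_, fun r => ?_⟩
    · refine Measurable.ite measurableSet_Ioi ?_ measurable_const
      exact (intervalIntegral.continuous_primitive (hint q hq) 0).measurable.div (by fun_prop)
    · simp only [hT]
      split_ifs with hr
      · rw [le_div_iff₀ (by positivity), ← hpow]
        refine intervalIntegral.integral_mono_on hr.le (hpowi r m) (hint q hq 0 r) fun ρ hρ => ?_
        have hρ0 := hρ.1
        gcongr
        exact (hFm ρ).trans (hFmono ρ m _ le_rfl (hq.2.1 ρ) (hq.2.2 ρ))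
      · exact le_rfl
    · simp only [hT]
      split_ifs with hr
      · rw [div_le_iff₀ (by positivity), ← hpow]
        refine intervalIntegral.integral_mono_on hr.le (hint q hq 0 r) (hpowi r M) fun ρ hρ => ?_
        have hρ0 := hρ.1
        gcongr
        exact (hFmono ρ _ M (hq.2.1 ρ) (hq.2.2 ρ) le_rfl).trans (hFM ρ)
      · exact hmM
  have hTmono : ∀ q q', P q → P q' → (∀ r, q r ≤ q' r) → ∀ r, T q r ≤ T q' r := by
    intro q q' hq hq' hqq r
    simp only [hT]
    split_ifs with hr
    · gcongr
      refine intervalIntegral.integral_mono_on hr.le (hint q hq 0 r) (hint q' hq' 0 r)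
        fun ρ hρ => ?_
      have hρ0 := hρ.1
      gcongr
      exact hFmono ρ _ _ (hq.2.1 ρ) (hqq ρ) (hq'.2.2 ρ)
    · exact le_rfl
  -- Iterating from the subsolution gives an increasing sequence bounded by `M`. Its pointwise limit
  -- is a fixed point of `T` on `(0, ∞)` by dominated convergence.
  set Q : ℕ → ℝ → ℝ := fun k => T^[k] (fun _ => m) with hQ
  have hQs : ∀ k, Q (k + 1) = T (Q k) := fun k => Function.iterate_succ_apply' _ _ _
  have hQP : ∀ k, P (Q k) := by
    intro k
    induction k with
    | zero => exact ⟨measurable_const, fun _ => le_rfl, fun _ => hmM⟩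
    | succ k ih => rw [hQs]; exact hTP _ ih
  have hQm : ∀ k r, Q k r ≤ Q (k + 1) r := by
    intro k
    induction k with
    | zero => exact fun r => (hQP 1).2.1 r
    | succ k ih =>
      rw [hQs, hQs (k + 1)]
      exact hTmono _ _ (hQP k) (hQP (k + 1)) ih
  set q : ℝ → ℝ := fun r => ⨆ k, Q k r with hq
  have hlim : ∀ r, Tendsto (fun k => Q k r) atTop (𝓝 (q r)) := fun r =>
    tendsto_atTop_ciSup (monotone_nat_of_le_succ fun k => hQm k r)
      ⟨M, by rintro _ ⟨k, rfl⟩; exact (hQP k).2.2 r⟩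
  have hqmeas : Measurable q :=
    measurable_of_tendsto_metrizable (fun k => (hQP k).1) (tendsto_pi_nhds.2 hlim)
  refine ⟨q, N, m, M, hm0, hqmeas, fun r => ge_of_tendsto' (hlim r) fun k => (hQP k).2.1 r,
    fun r => le_of_tendsto' (hlim r) fun k => (hQP k).2.2 r, fun r hr => ?_⟩
  have h1 : Tendsto (fun k => ∫ ρ in (0 : ℝ)..r, ρ ^ N * F ρ (Q k ρ)) atTop
      (𝓝 (∫ ρ in (0 : ℝ)..r, ρ ^ N * F ρ (q ρ))) := by
    refine intervalIntegral.tendsto_integral_filter_of_dominated_convergence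
      (fun ρ => |ρ| ^ N * ((N + 1) * M)) (Eventually.of_forall fun k =>
        (hFmeas _ (hQP k)).aestronglyMeasurable) (Eventually.of_forall fun k =>
        Eventually.of_forall fun ρ _ => ?_)
      (Continuous.intervalIntegrable (by fun_prop) _ _) (Eventually.of_forall fun ρ _ => ?_)
    · rw [norm_mul, norm_pow, Real.norm_eq_abs, Real.norm_eq_abs]
      gcongr
      exact hFb ρ _ ((hQP k).2.1 ρ) ((hQP k).2.2 ρ)
    · have := hlim ρ
      simp only [hF]
      exact (((this.const_mul _).const_add _).sub ((this.pow 2).const_mul _)).const_mul _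
  have h2 : Tendsto (fun k => Q (k + 1) r * r ^ (N + 1)) atTop (𝓝 (q r * r ^ (N + 1))) :=
    ((tendsto_add_atTop_iff_nat 1).2 (hlim r)).mul_const _
  refine tendsto_nhds_unique h2 (h1.congr fun k => ?_)
  rw [hQs]
  simp only [hT, if_pos hr]
  field_simp

/-! ### Locally Lipschitz functions and primitives on the half-line. -/

/-- Post-composition of a locally Lipschitz map with a `C¹` map. -/
lemma LocallyLipschitzOn.contDiffAt_comp {X E' F' : Type*} [PseudoMetricSpace X]
    [NormedAddCommGroup E'] [NormedSpace ℝ E'] [NormedAddCommGroup F'] [NormedSpace ℝ F']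
    {g : X → E'} {s : Set X} (hg : LocallyLipschitzOn s g) {Φ : E' → F'}
    (hΦ : ∀ x ∈ s, ContDiffAt ℝ 1 Φ (g x)) : LocallyLipschitzOn s (fun x => Φ (g x)) := by
  intro x hx
  obtain ⟨K, t, ht, hK⟩ := hg hx
  obtain ⟨L, t', ht', hL⟩ := (hΦ x hx).exists_lipschitzOnWith
  refine ⟨L * K, t ∩ g ⁻¹' t', inter_mem ht (hg.continuousOn x hx ht'), ?_⟩
  exact hL.comp (hK.mono inter_subset_left) fun y hy => hy.2

lemma LocallyLipschitzOn.prodMk_mk {X Y Z : Type*} [PseudoEMetricSpace X]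
    [PseudoEMetricSpace Y] [PseudoEMetricSpace Z] {f : X → Y} {g : X → Z} {s : Set X}
    (hf : LocallyLipschitzOn s f) (hg : LocallyLipschitzOn s g) :
    LocallyLipschitzOn s fun x => (f x, g x) := by
  intro x hx
  obtain ⟨K, t, ht, hK⟩ := hf hx
  obtain ⟨L, t', ht', hL⟩ := hg hx
  exact ⟨max K L, t ∩ t', inter_mem ht ht',
    (hK.mono inter_subset_left).prodMk (hL.mono inter_subset_right)⟩

section Primitive

variable {p : ℝ → ℝ}

lemma intervalIntegrable_of_locally_bounded (hp : Measurable p)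
    (hb : ∀ δ L : ℝ, 0 < δ → ∃ C, ∀ ρ ∈ Icc δ L, |p ρ| ≤ C) {x y : ℝ} (hx : 0 < x) (hy : 0 < y) :
    IntervalIntegrable p volume x y := by
  obtain ⟨C, hC⟩ := hb (min x y) (max x y) (lt_min hx hy)
  refine (intervalIntegrable_const (c := C)).mono_fun hp.aestronglyMeasurable ?_
  filter_upwards [ae_restrict_mem measurableSet_uIoc] with ρ hρ
  exact (hC ρ (uIoc_subset_uIcc hρ)).trans (le_abs_self C)

lemma locallyLipschitzOn_primitive (hp : Measurable p)
    (hb : ∀ δ L : ℝ, 0 < δ → ∃ C, ∀ ρ ∈ Icc δ L, |p ρ| ≤ C) :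
    LocallyLipschitzOn (Ioi 0) fun r => ∫ ρ in (1 : ℝ)..r, p ρ := by
  intro x hx
  rw [mem_Ioi] at hx
  obtain ⟨C, hC⟩ := hb (x / 2) (2 * x) (by positivity)
  have hC0 : 0 ≤ C := (abs_nonneg _).trans (hC x ⟨by linarith, by linarith⟩)
  refine ⟨C.toNNReal, Icc (x / 2) (2 * x),
    mem_nhdsWithin_of_mem_nhds (Icc_mem_nhds (by linarith) (by linarith)), ?_⟩
  refine LipschitzOnWith.of_dist_le_mul fun y hy z hz => ?_
  have hy0 : 0 < y := by linarith [hy.1]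
  have hz0 : 0 < z := by linarith [hz.1]
  have hi := fun {u v : ℝ} (hu : 0 < u) (hv : 0 < v) =>
    intervalIntegrable_of_locally_bounded hp hb hu hv
  rw [Real.dist_eq, intervalIntegral.integral_interval_sub_left (hi one_pos hy0)
    (hi one_pos hz0), Real.coe_toNNReal C hC0, Real.dist_eq]
  refine intervalIntegral.norm_integral_le_of_norm_le_const fun ρ hρ =>
    (Real.norm_eq_abs _).trans_le (hC ρ ?_)
  exact uIcc_subset_Icc hz hy (uIoc_subset_uIcc hρ)

/-- Lebesgue differentiation applies on each `[1/(k+1), k+1]`. These countably many intervals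
exhaust `(0, ∞)`, and all contain the base point `1`. -/
lemma ae_hasDerivAt_primitive (hp : Measurable p)
    (hb : ∀ δ L : ℝ, 0 < δ → ∃ C, ∀ ρ ∈ Icc δ L, |p ρ| ≤ C) :
    ∀ᵐ r : ℝ, 0 < r → HasDerivAt (fun r => ∫ ρ in (1 : ℝ)..r, p ρ) (p r) r := by
  have h : ∀ k : ℕ, ∀ᵐ r : ℝ, r ∈ uIcc (1 / (k + 1) : ℝ) (k + 1) → ∀ c ∈ uIcc (1 / (k + 1) : ℝ)
      (k + 1), HasDerivAt (fun r => ∫ ρ in c..r, p ρ) (p r) r := fun k =>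
    (intervalIntegrable_of_locally_bounded hp hb (by positivity)
      (by positivity)).ae_hasDerivAt_integral
  filter_upwards [ae_all_iff.2 h] with r hr hr0
  obtain ⟨k, hk⟩ := exists_nat_ge (r + 1 / r)
  have hr' : 0 < 1 / r := by positivity
  have hk1 : 1 / (k + 1 : ℝ) ≤ 1 := by
    rw [div_le_one (by positivity)]; linarith [(Nat.cast_nonneg k : (0 : ℝ) ≤ k)]
  have hk2 : 1 / (k + 1 : ℝ) ≤ r := by
    rw [div_le_iff₀ (by positivity)]
    have : r * (1 / r) = 1 := by field_simp
    nlinarith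
  have hk3 : (1 : ℝ) ≤ k + 1 := by linarith [(Nat.cast_nonneg k : (0 : ℝ) ≤ k)]
  have hrk := hr k
  rw [uIcc_of_le (hk1.trans hk3)] at hrk
  exact hrk ⟨hk2, by linarith⟩ 1 ⟨hk1, hk3⟩

end Primitive

/-- Local form of the Riccati equation. -/
lemma exists_riccati_solution_hasDerivAt {κ a₀ a₁ : ℝ} (hκ : 1 ≤ κ) (ha₀ : 0 < a₀) {a : ℝ → ℝ}
    (ha : Measurable a) (hal : ∀ r, a₀ ≤ a r) (hau : ∀ r, a r ≤ a₁) :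
    ∃ (q : ℝ → ℝ) (m M : ℝ), 0 < m ∧ Measurable q ∧ (∀ r, m ≤ q r) ∧ (∀ r, q r ≤ M) ∧
      LocallyLipschitzOn (Ioi 0) q ∧
      ∀ᵐ r : ℝ, 0 < r → HasDerivAt q ((κ - (κ - 1) * q r - a r * q r ^ 2) / r) r := by
  obtain ⟨q, N, m, M, hm, hq, hqm, hqM, hqi⟩ := exists_riccati_solution hκ ha₀ ha hal hau
  set p : ℝ → ℝ := fun ρ => ρ ^ N * (κ + (N + 2 - κ) * q ρ - a ρ * q ρ ^ 2) with hp
  have hpm : Measurable p := by simp only [hp]; fun_prop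
  have hpb : ∀ L : ℝ, ∃ C, ∀ ρ ∈ Icc 0 L, |p ρ| ≤ C := by
    intro L
    refine ⟨L ^ N * (|κ| + |(N + 2 - κ : ℝ)| * M + a₁ * M ^ 2), fun ρ hρ => ?_⟩
    have hρ0 := hρ.1
    have hL0 : 0 ≤ L := hρ0.trans hρ.2
    have hq0 : 0 ≤ q ρ := hm.le.trans (hqm ρ)
    have ha0 : 0 ≤ a ρ := ha₀.le.trans (hal ρ)
    simp only [hp]
    rw [abs_mul, abs_of_nonneg (by positivity : 0 ≤ ρ ^ N)]
    have h1 : |κ + (N + 2 - κ) * q ρ - a ρ * q ρ ^ 2| ≤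
        |κ| + |(N + 2 - κ : ℝ)| * M + a₁ * M ^ 2 := by
      refine (abs_sub _ _).trans (add_le_add ((abs_add_le _ _).trans (add_le_add le_rfl ?_)) ?_)
      · rw [abs_mul, abs_of_nonneg hq0]; gcongr; exact hqM ρ
      · rw [abs_of_nonneg (by positivity)]
        gcongr
        · exact ha₀.le.trans ((hal 0).trans (hau 0))
        · exact hau ρ
        · exact hqM ρ
    gcongr
    exact hρ.2
  have hpb' : ∀ δ L : ℝ, 0 < δ → ∃ C, ∀ ρ ∈ Icc δ L, |p ρ| ≤ C := fun δ L hδ =>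
    (hpb L).imp fun C hC ρ hρ => hC ρ ⟨hδ.le.trans hρ.1, hρ.2⟩
  have h01 : IntervalIntegrable p volume 0 1 := by
    obtain ⟨C, hC⟩ := hpb 1
    refine (intervalIntegrable_const (c := C)).mono_fun hpm.aestronglyMeasurable ?_
    filter_upwards [ae_restrict_mem measurableSet_uIoc] with ρ hρ
    rw [uIoc_of_le zero_le_one] at hρ
    exact (hC ρ ⟨hρ.1.le, hρ.2⟩).trans (le_abs_self C)
  set c := ∫ ρ in (0 : ℝ)..1, p ρ with hc
  -- The integral equation exhibits `q` as a smooth function of `r` and a primitive of a locally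
  -- bounded function, so `q` inherits local Lipschitz continuity and a.e. differentiability.
  set Φ : ℝ × ℝ → ℝ := fun z => (c + z.1) / z.2 ^ (N + 1) with hΦ
  have hqΦ : ∀ r, 0 < r → q r = Φ (∫ ρ in (1 : ℝ)..r, p ρ, r) := by
    intro r hr
    simp only [hΦ, hc]
    rw [intervalIntegral.integral_add_adjacent_intervals h01
      (intervalIntegrable_of_locally_bounded hpm hpb' one_pos hr), eq_div_iff (by positivity)]
    exact hqi r hr
  refine ⟨q, m, M, hm, hq, hqm, hqM, ?_, ?_⟩
  · have h1 : LocallyLipschitzOn (Ioi 0) fun r : ℝ => ((∫ ρ in (1 : ℝ)..r, p ρ), r) :=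
      (locallyLipschitzOn_primitive hpm hpb').prodMk_mk LocallyLipschitz.id.locallyLipschitzOn
    have h2 : LocallyLipschitzOn (Ioi 0) fun r : ℝ => Φ (∫ ρ in (1 : ℝ)..r, p ρ, r) := by
      refine h1.contDiffAt_comp fun r (hr : 0 < r) => ?_
      exact (contDiffAt_const.add contDiffAt_fst).div (contDiffAt_snd.pow _)
        (pow_ne_zero _ hr.ne')
    intro r hr
    obtain ⟨K, t, ht, hK⟩ := h2 hr
    refine ⟨K, t ∩ Ioi 0, inter_mem ht self_mem_nhdsWithin, fun x hx y hy => ?_⟩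
    rw [hqΦ x hx.2, hqΦ y hy.2]
    exact hK hx.1 hy.1
  · filter_upwards [ae_hasDerivAt_primitive hpm hpb'] with r hr hr0
    have h1 := ((hr hr0).const_add c).div (hasDerivAt_pow (N + 1) r) (pow_ne_zero _ hr0.ne')
    have h2 : HasDerivAt q _ r := h1.congr_of_eventuallyEq
      ((eventually_gt_nhds hr0).mono fun x hx => hqΦ x hx)
    convert! h2 using 1
    have h3 : c + ∫ ρ in (1 : ℝ)..r, p ρ = q r * r ^ (N + 1) := by
      rw [hqΦ r hr0]; simp only [hΦ]; field_simp
    rw [h3]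
    simp only [hp]
    push_cast
    field_simp
    ring

/-! ### Integration by parts across the origin. -/

section WeakDerivative

variable {n : ℕ}

/-- Integration by parts for a function that is locally Lipschitz away from the origin, against a
smooth function supported away from the origin. -/
lemma integral_mul_fderiv_of_locallyLipschitzOn {f D : Eu n → ℝ} {e : Eu n}
    (hf : LocallyLipschitzOn {0}ᶜ f) (hD : ∀ᵐ x, x ≠ 0 → HasLineDerivAt ℝ f (D x) x e)
    {ψ : Eu n → ℝ} (hψ : ContDiff ℝ ∞ ψ) (hψc : HasCompactSupport ψ) (hψ0 : (0 : Eu n) ∉ tsupport ψ) :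
    ∫ x, f x * fderiv ℝ ψ x e = - ∫ x, D x * ψ x := by
  -- On a compact neighbourhood of the support, `f` is Lipschitz. It can be replaced by a global
  -- Lipschitz extension, for which integration by parts is available.
  obtain ⟨K', hK', hKK', hK'0⟩ := exists_compact_between hψc.isCompact
    (isOpen_compl_singleton (x := (0 : Eu n))) (subset_compl_singleton_iff.2 hψ0)
  obtain ⟨L, hL⟩ := (hf.mono hK'0).exists_lipschitzOnWith_of_compact hK'
  obtain ⟨F, hF, hFf⟩ := hL.extend_real
  obtain ⟨C, hC⟩ := hψ.lipschitzWith_of_hasCompactSupport hψc (by simp)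
  have key := hF.integral_lineDeriv_mul_eq (μ := volume) hC hψc e
  have hψd : Differentiable ℝ ψ := hψ.differentiable (by simp)
  have h1 : ∫ x, lineDeriv ℝ F x e * ψ x = ∫ x, D x * ψ x := by
    apply integral_congr_ae
    filter_upwards [hD] with x hx
    by_cases hxK : x ∈ tsupport ψ
    · have hx0 : x ≠ 0 := fun h => hψ0 (h ▸ hxK)
      have hnear : F =ᶠ[𝓝 x] f := by
        filter_upwards [mem_interior_iff_mem_nhds.1 (hKK' hxK)] with y hy using (hFf hy).symm
      rw [hnear.lineDeriv_eq, (hx hx0).lineDeriv]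
    · rw [image_eq_zero_of_notMem_tsupport hxK, mul_zero, mul_zero]
  have h2 : ∫ x, lineDeriv ℝ ψ x (-e) * F x = - ∫ x, f x * fderiv ℝ ψ x e := by
    rw [← integral_neg]
    apply integral_congr_ae
    filter_upwards with x
    rw [(hψd x).lineDeriv_eq_fderiv, map_neg]
    by_cases hxK : x ∈ tsupport ψ
    · rw [hFf (interior_subset (hKK' hxK))]; ring
    · have : fderiv ℝ ψ x = 0 := by
        by_contra h
        exact hxK (support_fderiv_subset ℝ h)
      simp [this]
  rw [h1, h2] at key
  rw [key, neg_neg]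

/-- A smooth cut-off of the real line: zero on `(-∞, 1]` and one on `[2, ∞)`. -/
noncomputable def cutoff (s : ℝ) : ℝ := Real.smoothTransition (s - 1)

lemma contDiff_cutoff : ContDiff ℝ ∞ cutoff :=
  Real.smoothTransition.contDiff.comp (contDiff_id.sub contDiff_const)

lemma cutoff_of_le {s : ℝ} (hs : s ≤ 1) : cutoff s = 0 :=
  Real.smoothTransition.zero_of_nonpos (by linarith)

lemma cutoff_of_ge {s : ℝ} (hs : 2 ≤ s) : cutoff s = 1 :=
  Real.smoothTransition.one_of_one_le (by linarith)

lemma abs_cutoff_le (s : ℝ) : |cutoff s| ≤ 1 := by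
  rw [cutoff, abs_of_nonneg (Real.smoothTransition.nonneg _)]
  exact Real.smoothTransition.le_one _

lemma deriv_cutoff_of_lt {s : ℝ} (hs : s < 1) : deriv cutoff s = 0 := by
  have : cutoff =ᶠ[𝓝 s] fun _ => 0 := (eventually_lt_nhds hs).mono fun x hx => cutoff_of_le hx.le
  rw [this.deriv_eq, deriv_const]

lemma deriv_cutoff_of_gt {s : ℝ} (hs : 2 < s) : deriv cutoff s = 0 := by
  have : cutoff =ᶠ[𝓝 s] fun _ => 1 := (eventually_gt_nhds hs).mono fun x hx => cutoff_of_ge hx.le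
  rw [this.deriv_eq, deriv_const]

/-- This scale-invariant bound makes `|x| |∇η_k|` bounded uniformly in `k` for the rescaled cut-offs
`η_k(x) = cutoff (k² |x|²)`. -/
lemma exists_abs_mul_deriv_cutoff_le : ∃ C, ∀ s, |s * deriv cutoff s| ≤ C := by
  have hc : Continuous (deriv cutoff) := contDiff_cutoff.continuous_deriv (by simp)
  obtain ⟨C, hC⟩ := (isCompact_Icc (a := (1 : ℝ)) (b := 2)).exists_bound_of_continuousOn
    (f := fun s => s * deriv cutoff s) (by fun_prop)
  have hC0 : 0 ≤ C := (norm_nonneg _).trans (hC 1 (by simp))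
  refine ⟨C, fun s => ?_⟩
  rcases lt_or_ge s 1 with h1 | h1
  · rw [deriv_cutoff_of_lt h1, mul_zero, abs_zero]; exact hC0
  rcases lt_or_ge 2 s with h2 | h2
  · rw [deriv_cutoff_of_gt h2, mul_zero, abs_zero]; exact hC0
  · exact hC s ⟨h1, h2⟩

lemma hasFDerivAt_cutoff_norm_sq (c : ℝ) (x : Eu n) :
    HasFDerivAt (fun x : Eu n => cutoff (c * ‖x‖ ^ 2))
      ((deriv cutoff (c * ‖x‖ ^ 2) * c) • (2 : ℝ) • innerSL ℝ x) x := by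
  have h1 : HasFDerivAt (fun x : Eu n => c * ‖x‖ ^ 2) (c • (2 : ℝ) • innerSL ℝ x) x := by
    have := (hasStrictFDerivAt_norm_sq x).hasFDerivAt.const_mul c
    simpa [← Nat.cast_smul_eq_nsmul ℝ] using this
  have h2 : HasDerivAt cutoff (deriv cutoff (c * ‖x‖ ^ 2)) (c * ‖x‖ ^ 2) :=
    (contDiff_cutoff.differentiable (by simp) _).hasDerivAt
  have := h2.comp_hasFDerivAt x h1
  rwa [smul_smul] at this

/-- Integration by parts across the origin: the singularity at `0` is removable as soon as
`f / |x|` is integrable. -/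
lemma setIntegral_mul_pderiv_of_locallyLipschitzOn {R : ℝ} {f D : Eu n → ℝ} (i : Fin n)
    (hf : LocallyLipschitzOn {0}ᶜ f)
    (hD : ∀ᵐ x, x ≠ 0 → HasLineDerivAt ℝ f (D x) x (EuclideanSpace.single i 1))
    (hfi : IntegrableOn (fun x => f x / ‖x‖) (Metric.ball 0 R))
    (hDi : IntegrableOn D (Metric.ball 0 R))
    {φ : Eu n → ℝ} (hφ : IsTestFunction (Metric.ball 0 R) φ) :
    ∫ x in Metric.ball 0 R, f x * pderiv i φ x = - ∫ x in Metric.ball 0 R, D x * φ x := by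
  have : Nonempty (Fin n) := ⟨i⟩
  obtain ⟨hφs, hφc, hφR⟩ := hφ
  set e : Eu n := EuclideanSpace.single i 1 with he
  have hφd : Differentiable ℝ φ := hφs.differentiable (by simp)
  have hφ1 : Continuous fun x => fderiv ℝ φ x e :=
    (hφs.continuous_fderiv (by simp)).clm_apply continuous_const
  obtain ⟨A, hA⟩ := hφc.exists_bound_of_continuous hφs.continuous
  obtain ⟨B, hB⟩ := (hφc.fderiv_apply ℝ e).exists_bound_of_continuous hφ1
  obtain ⟨C, hC⟩ := exists_abs_mul_deriv_cutoff_le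
  have hA0 : 0 ≤ A := (norm_nonneg _).trans (hA 0)
  have hB0 : 0 ≤ B := (norm_nonneg _).trans (hB 0)
  have hC0 : 0 ≤ C := (abs_nonneg _).trans (hC 0)
  -- Zero for `k|x| ≤ 1` and one for `k²|x|² ≥ 2`; using the squared norm keeps it smooth at the
  -- origin.
  set η : ℕ → Eu n → ℝ := fun k x => cutoff ((k : ℝ) ^ 2 * ‖x‖ ^ 2) with hη
  have hηs : ∀ k, ContDiff ℝ ∞ (η k) := fun k =>
    contDiff_cutoff.comp (contDiff_const.mul (contDiff_norm_sq ℝ))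
  set ψ : ℕ → Eu n → ℝ := fun k x => φ x * η k x with hψ
  have hψs : ∀ k, ContDiff ℝ ∞ (ψ k) := fun k => hφs.mul (hηs k)
  have hψc : ∀ k, HasCompactSupport (ψ k) := fun k => hφc.mul_right
  have hψ0 : ∀ k, (0 : Eu n) ∉ tsupport (ψ k) := by
    intro k
    rw [notMem_tsupport_iff_eventuallyEq]
    have hcont : Continuous fun x : Eu n => (k : ℝ) ^ 2 * ‖x‖ ^ 2 := by fun_prop
    have : ∀ᶠ x in 𝓝 (0 : Eu n), (k : ℝ) ^ 2 * ‖x‖ ^ 2 < 1 :=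
      (hcont.tendsto 0).eventually (eventually_lt_nhds (by simp))
    filter_upwards [this] with x hx
    simp only [hψ, hη, cutoff_of_le hx.le, mul_zero, Pi.zero_apply]
  have hψd : ∀ k x, fderiv ℝ (ψ k) x e = fderiv ℝ φ x e * η k x +
      φ x * (deriv cutoff ((k : ℝ) ^ 2 * ‖x‖ ^ 2) * (k : ℝ) ^ 2 * (2 * x i)) := by
    intro k x
    have h := (hφd x).hasFDerivAt.mul (hasFDerivAt_cutoff_norm_sq ((k : ℝ) ^ 2) x)
    rw [show fderiv ℝ (ψ k) x = _ from h.fderiv]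
    simp [hη, he, EuclideanSpace.inner_single_right]
    ring
  have hsupp : ∀ k x, x ∉ Metric.ball (0 : Eu n) R → x ∉ tsupport (ψ k) := fun k x hx h =>
    hx (hφR (tsupport_mul_subset_left h))
  have hk : ∀ k, ∫ x in Metric.ball 0 R, f x * fderiv ℝ (ψ k) x e =
      - ∫ x in Metric.ball 0 R, D x * ψ k x := by
    intro k
    rw [setIntegral_eq_integral_of_forall_compl_eq_zero,
      setIntegral_eq_integral_of_forall_compl_eq_zero]
    · exact integral_mul_fderiv_of_locallyLipschitzOn hf hD (hψs k) (hψc k) (hψ0 k)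
    · intro x hx
      rw [image_eq_zero_of_notMem_tsupport (hsupp k x hx), mul_zero]
    · intro x hx
      have : fderiv ℝ (ψ k) x = 0 := by
        by_contra h
        exact hsupp k x hx (support_fderiv_subset ℝ h)
      simp [this]
  have hlarge : ∀ x : Eu n, x ≠ 0 → ∀ᶠ k : ℕ in atTop, 2 < (k : ℝ) ^ 2 * ‖x‖ ^ 2 := by
    intro x hx
    have h1 : Tendsto (fun k : ℕ => (k : ℝ) ^ 2 * ‖x‖ ^ 2) atTop atTop :=
      ((tendsto_pow_atTop two_ne_zero).comp tendsto_natCast_atTop_atTop).atTop_mul_const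
        (by positivity)
    exact h1.eventually_gt_atTop 2
  have hne : ∀ᵐ x ∂(volume.restrict (Metric.ball (0 : Eu n) R)), x ≠ 0 :=
    ae_restrict_of_ae (by simp [ae_iff, measure_singleton])
  have lim1 : Tendsto (fun k => ∫ x in Metric.ball 0 R, D x * ψ k x) atTop
      (𝓝 (∫ x in Metric.ball 0 R, D x * φ x)) := by
    refine tendsto_integral_of_dominated_convergence (fun x => ‖D x‖ * A)
      (fun k => hDi.aestronglyMeasurable.mul (hψs k).continuous.aestronglyMeasurable)
      (hDi.norm.mul_const A) (fun k => Eventually.of_forall fun x => ?_) ?_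
    · rw [norm_mul]
      gcongr
      simp only [hψ]
      rw [norm_mul]
      exact (mul_le_of_le_one_right (norm_nonneg _) (abs_cutoff_le _)).trans (hA x)
    · filter_upwards [hne] with x hx
      refine tendsto_const_nhds.congr' ?_
      filter_upwards [hlarge x hx] with k hk
      simp only [hψ, hη, cutoff_of_ge hk.le, mul_one]
  have lim2 : Tendsto (fun k => ∫ x in Metric.ball 0 R, f x * fderiv ℝ (ψ k) x e) atTop
      (𝓝 (∫ x in Metric.ball 0 R, f x * fderiv ℝ φ x e)) := by
    have hfm : AEStronglyMeasurable f (volume.restrict (Metric.ball (0 : Eu n) R)) := by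
      have h1 : AEStronglyMeasurable (fun x => f x / ‖x‖ * ‖x‖)
          (volume.restrict (Metric.ball (0 : Eu n) R)) :=
        hfi.aestronglyMeasurable.mul continuous_norm.aestronglyMeasurable
      refine h1.congr ?_
      filter_upwards [hne] with x hx
      field_simp
    -- The derivative of `φ η_k` is `O(1/|x|)` uniformly in `k`, so `|f|/|x|` times a constant is a
    -- majorant. This is where integrability of `f/|x|` is needed.
    refine tendsto_integral_of_dominated_convergence (fun x => ‖f x / ‖x‖‖ * (R * B + A * (2 * C)))
      (fun k => hfm.mul (((hψs k).continuous_fderiv (by simp)).clm_apply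
        continuous_const).aestronglyMeasurable)
      (hfi.norm.mul_const _) (fun k => ?_) ?_
    · filter_upwards [hne, ae_restrict_mem measurableSet_ball] with x hx hxR
      have hxR' : ‖x‖ ≤ R := by simpa using (mem_ball_zero_iff.1 hxR).le
      have hxpos : 0 < ‖x‖ := norm_pos_iff.2 hx
      have hR0 : 0 ≤ R := hxpos.le.trans hxR'
      have h1 : f x * fderiv ℝ (ψ k) x e = f x / ‖x‖ * (‖x‖ * fderiv ℝ (ψ k) x e) := by
        field_simp
      rw [h1, norm_mul]
      gcongr
      rw [hψd, mul_add]
      refine (norm_add_le _ _).trans (add_le_add ?_ ?_)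
      · rw [norm_mul, norm_norm, norm_mul]
        gcongr
        exact (mul_le_of_le_one_right (norm_nonneg _) (abs_cutoff_le _)).trans (hB x)
      · have h2 : ‖x‖ * (φ x * (deriv cutoff ((k : ℝ) ^ 2 * ‖x‖ ^ 2) * (k : ℝ) ^ 2 * (2 * x i))) =
            φ x * ((2 * (x i / ‖x‖)) *
              (((k : ℝ) ^ 2 * ‖x‖ ^ 2) * deriv cutoff ((k : ℝ) ^ 2 * ‖x‖ ^ 2))) := by
          field_simp
        rw [h2, norm_mul, norm_mul]
        have h3 : ‖2 * (x i / ‖x‖)‖ ≤ 2 := by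
          rw [norm_mul, norm_div, norm_norm]
          have : ‖x i‖ / ‖x‖ ≤ 1 := div_le_one_of_le₀ (PiLp.norm_apply_le x i) hxpos.le
          norm_num
          simpa using this
        have h4 := hC ((k : ℝ) ^ 2 * ‖x‖ ^ 2)
        rw [← Real.norm_eq_abs] at h4
        have h5 := hA x
        gcongr
    · filter_upwards [hne] with x hx
      refine tendsto_const_nhds.congr' ?_
      filter_upwards [hlarge x hx] with k hk
      rw [hψd, deriv_cutoff_of_gt hk]
      simp only [hη, cutoff_of_ge hk.le]
      ring
  exact tendsto_nhds_unique lim2 (lim1.neg.congr fun k => (hk k).symm)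

end WeakDerivative

/-! ### Radial derivatives and the first spherical eigenfunctions. -/

section Sphere

variable {n : ℕ}

lemma hasFDerivAt_norm_of_ne {x : Eu n} (hx : x ≠ 0) :
    HasFDerivAt (fun x : Eu n => ‖x‖) (‖x‖⁻¹ • innerSL ℝ x) x := by
  have h0 : ‖x‖ ≠ 0 := norm_ne_zero_iff.2 hx
  have h1 := (hasStrictFDerivAt_norm_sq x).hasFDerivAt.sqrt (pow_ne_zero 2 h0)
  simp only [Real.sqrt_sq (norm_nonneg _)] at h1
  convert! h1 using 1
  rw [← Nat.cast_smul_eq_nsmul ℝ, smul_smul]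
  congr 1
  push_cast
  field_simp

/-- The derivative of a radial function. -/
lemma HasDerivAt.hasFDerivAt_comp_norm {k : ℝ → ℝ} {k' : ℝ} {x : Eu n} (hk : HasDerivAt k k' ‖x‖)
    (hx : x ≠ 0) : HasFDerivAt (fun x : Eu n => k ‖x‖) ((k' / ‖x‖) • innerSL ℝ x) x := by
  have := hk.comp_hasFDerivAt x (hasFDerivAt_norm_of_ne hx)
  rwa [smul_smul] at this

lemma HasDerivAt.hasLineDerivAt_comp_norm {k : ℝ → ℝ} {k' : ℝ} {x : Eu n}
    (hk : HasDerivAt k k' ‖x‖) (hx : x ≠ 0) (i : Fin n) :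
    HasLineDerivAt ℝ (fun x : Eu n => k ‖x‖) (k' / ‖x‖ * x i) x (EuclideanSpace.single i 1) := by
  have := (hk.hasFDerivAt_comp_norm hx).hasLineDerivAt (EuclideanSpace.single i 1)
  simpa [EuclideanSpace.inner_single_right] using this

lemma hasFDerivAt_coord (i : Fin n) (x : Eu n) :
    HasFDerivAt (fun x : Eu n => x i) (EuclideanSpace.proj i : Eu n →L[ℝ] ℝ) x :=
  (EuclideanSpace.proj i : Eu n →L[ℝ] ℝ).hasFDerivAt

lemma hasLineDerivAt_coord (i j : Fin n) (x : Eu n) :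
    HasLineDerivAt ℝ (fun x : Eu n => x j) (if i = j then 1 else 0) x
      (EuclideanSpace.single i 1) := by
  have := (hasFDerivAt_coord j x).hasLineDerivAt (EuclideanSpace.single i (1 : ℝ))
  simpa [Pi.single_apply, eq_comm] using this

lemma sum_coord_sq (x : Eu n) : ∑ i, x i ^ 2 = ‖x‖ ^ 2 := by
  rw [EuclideanSpace.norm_sq_eq]
  simp

lemma radialExt_coord (i₀ : Fin n) :
    radialExt (fun x : Eu n => x i₀) = fun x => ‖x‖⁻¹ * x i₀ := by
  funext x
  simp [radialExt]

lemma contDiffOn_radialExt_coord (i₀ : Fin n) :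
    ContDiffOn ℝ ∞ (radialExt fun x : Eu n => x i₀) {0}ᶜ := by
  rw [radialExt_coord]
  intro x hx
  have h1 : ContDiffAt ℝ ∞ (fun x : Eu n => x i₀) x :=
    (EuclideanSpace.proj i₀ : Eu n →L[ℝ] ℝ).contDiff.contDiffAt
  exact (((contDiffAt_norm ℝ hx).inv (norm_ne_zero_iff.2 hx)).mul h1).contDiffWithinAt

lemma hasDerivAt_inv_pow (m : ℕ) {r : ℝ} (hr : r ≠ 0) :
    HasDerivAt (fun r : ℝ => (r ^ m)⁻¹) (-(m * (r ^ (m + 1))⁻¹)) r := by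
  rcases m with - | m
  · simpa using hasDerivAt_const r (1 : ℝ)
  · convert! (hasDerivAt_pow (m + 1) r).inv (pow_ne_zero _ hr) using 1
    field_simp
    simp
    ring

lemma fderiv_radialExt_coord (i₀ i : Fin n) {x : Eu n} (hx : x ≠ 0) :
    fderiv ℝ (radialExt fun x : Eu n => x i₀) x (EuclideanSpace.single i 1) =
      (‖x‖ ^ 1)⁻¹ * (if i = i₀ then 1 else 0) - (‖x‖ ^ 3)⁻¹ * (x i₀ * x i) := by
  have hx0 : ‖x‖ ≠ 0 := norm_ne_zero_iff.2 hx
  have h := ((hasDerivAt_inv_pow 1 hx0).hasFDerivAt_comp_norm hx).mul (hasFDerivAt_coord i₀ x)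
  have h' : HasFDerivAt (radialExt fun x : Eu n => x i₀) _ x :=
    h.congr_of_eventuallyEq (Eventually.of_forall fun y => by simp [radialExt])
  rw [h'.fderiv]
  simp [EuclideanSpace.inner_single_right, eq_comm]
  field_simp
  ring

lemma hasLineDerivAt_fderiv_radialExt_coord (i₀ i : Fin n) {x : Eu n} (hx : ‖x‖ = 1) :
    HasLineDerivAt ℝ (fun y => fderiv ℝ (radialExt fun x : Eu n => x i₀) y
      (EuclideanSpace.single i 1))
      ((if i = i₀ then -2 * x i₀ else 0) - x i₀ + 3 * x i₀ * x i ^ 2) x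
      (EuclideanSpace.single i 1) := by
  have hx0 : x ≠ 0 := norm_ne_zero_iff.1 (by rw [hx]; exact one_ne_zero)
  have h1 := ((hasDerivAt_inv_pow 1 (norm_ne_zero_iff.2 hx0)).hasFDerivAt_comp_norm hx0).mul_const
    (if i = i₀ then (1 : ℝ) else 0)
  have h2 := ((hasDerivAt_inv_pow 3 (norm_ne_zero_iff.2 hx0)).hasFDerivAt_comp_norm hx0).mul
    ((hasFDerivAt_coord i₀ x).mul (hasFDerivAt_coord i x))
  have h3 : HasFDerivAt (fun y => fderiv ℝ (radialExt fun x : Eu n => x i₀) y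
      (EuclideanSpace.single i 1)) _ x := (h1.sub h2).congr_of_eventuallyEq (by
    filter_upwards [isOpen_compl_singleton.mem_nhds hx0] with y hy
    exact fderiv_radialExt_coord i₀ i hy)
  convert! h3.hasLineDerivAt (EuclideanSpace.single i 1) using 1
  by_cases hi : i = i₀
  · subst hi
    simp [EuclideanSpace.inner_single_right, hx]
    ring
  · simp [EuclideanSpace.inner_single_right, hx, hi, Ne.symm hi]
    ring

/-- At `|θ| = 1` the second derivatives of `x_{i₀}/|x|` add up to `-2θ_{i₀} - nθ_{i₀} + 3θ_{i₀} =
-(n-1)θ_{i₀}`. -/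
lemma isSphereEigenfunction_coord (i₀ : Fin n) :
    IsSphereEigenfunction ((n : ℝ) - 1) (fun x : Eu n => x i₀) := by
  refine ⟨contDiffOn_radialExt_coord i₀, ⟨EuclideanSpace.single i₀ 1, by simp, by simp⟩, ?_⟩
  intro θ hθ
  have hθ1 : ‖θ‖ = 1 := by simpa using hθ
  have hθ0 : θ ≠ 0 := norm_ne_zero_iff.1 (by rw [hθ1]; exact one_ne_zero)
  rw [InnerProductSpace.laplacian_eq_iteratedFDeriv_orthonormalBasis _
    (EuclideanSpace.basisFun (Fin n) ℝ)]
  have hd : DifferentiableAt ℝ (fderiv ℝ (radialExt fun x : Eu n => x i₀)) θ := by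
    have h1 : ContDiffAt ℝ ∞ (radialExt fun x : Eu n => x i₀) θ :=
      (contDiffOn_radialExt_coord i₀).contDiffAt (isOpen_compl_singleton.mem_nhds hθ0)
    exact (h1.fderiv_right (m := 1) (by norm_cast)).differentiableAt (by simp)
  have h : ∀ i : Fin n, iteratedFDeriv ℝ 2 (radialExt fun x : Eu n => x i₀) θ
      ![EuclideanSpace.basisFun (Fin n) ℝ i, EuclideanSpace.basisFun (Fin n) ℝ i] =
      (if i = i₀ then -2 * θ i₀ else 0) - θ i₀ + 3 * θ i₀ * θ i ^ 2 := by
    intro i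
    rw [iteratedFDeriv_two_apply, ← (hasLineDerivAt_fderiv_radialExt_coord i₀ i hθ1).lineDeriv]
    have h2 := (hd.hasFDerivAt.clm_apply (hasFDerivAt_const
      (EuclideanSpace.single i (1 : ℝ)) θ)).hasLineDerivAt (EuclideanSpace.single i (1 : ℝ))
    rw [h2.lineDeriv]
    simp
  simp_rw [h]
  rw [Finset.sum_add_distrib, Finset.sum_sub_distrib, ← Finset.mul_sum, sum_coord_sq, hθ1]
  simp
  ring

end Sphere

/-! ### The radial profile and its growth at the origin. -/

section Profile

variable {κ a₀ a₁ m M : ℝ} {a q : ℝ → ℝ}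

lemma abs_mul_sub_one_div_le_of_bounds (ha₀ : 0 < a₀) (hal : ∀ r, a₀ ≤ a r) (hau : ∀ r, a r ≤ a₁)
    (hm : 0 < m) (hqm : ∀ r, m ≤ q r) (hqM : ∀ r, q r ≤ M) (δ L : ℝ) (hδ : 0 < δ) :
    ∃ C, ∀ ρ ∈ Icc δ L, |(a ρ * q ρ - 1) / ρ| ≤ C := by
  refine ⟨(a₁ * M + 1) / δ, fun ρ hρ => ?_⟩
  have hq0 : 0 ≤ q ρ := hm.le.trans (hqm ρ)
  have ha0 : 0 ≤ a ρ := ha₀.le.trans (hal ρ)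
  have h1 : a ρ * q ρ ≤ a₁ * M := mul_le_mul (hau ρ) (hqM ρ) hq0 (ha0.trans (hau ρ))
  have h2 : 0 ≤ a ρ * q ρ := mul_nonneg ha0 hq0
  rw [abs_div, abs_of_pos (hδ.trans_le hρ.1)]
  have h3 : |a ρ * q ρ - 1| ≤ a₁ * M + 1 := by rw [abs_le]; constructor <;> linarith
  exact div_le_div₀ (by linarith) h3 hδ hρ.1

/-- The radial profile `k = v / r`, where `r v' = a q v`. -/
lemma exists_radial_profile (ha₀ : 0 < a₀) (ha : Measurable a) (hal : ∀ r, a₀ ≤ a r)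
    (hau : ∀ r, a r ≤ a₁) (hm : 0 < m) (hq : Measurable q) (hqm : ∀ r, m ≤ q r)
    (hqM : ∀ r, q r ≤ M) :
    ∃ (k : ℝ → ℝ) (β : ℝ), 0 < β ∧ Measurable k ∧ LocallyLipschitzOn (Ioi 0) k ∧
      (∀ r, 0 < r → k r = Real.exp (∫ ρ in (1 : ℝ)..r, (a ρ * q ρ - 1) / ρ)) ∧
      (∀ᵐ r : ℝ, 0 < r → HasDerivAt k ((a r * q r - 1) * k r / r) r) ∧
      ∀ R, ∃ C, ∀ r ∈ Ioc 0 R, k r ≤ C * r ^ (β - 1) := by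
  set p : ℝ → ℝ := fun ρ => (a ρ * q ρ - 1) / ρ with hp
  have hpm : Measurable p := by simp only [hp]; fun_prop
  have hpb : ∀ δ L : ℝ, 0 < δ → ∃ C, ∀ ρ ∈ Icc δ L, |p ρ| ≤ C :=
    abs_mul_sub_one_div_le_of_bounds ha₀ hal hau hm hqm hqM
  have hlip := locallyLipschitzOn_primitive hpm hpb
  set e : ℝ → ℝ := fun r => Real.exp (∫ ρ in (1 : ℝ)..r, p ρ) with he
  have hek : LocallyLipschitzOn (Ioi 0) e :=
    hlip.contDiffAt_comp (Φ := Real.exp) fun x _ => Real.contDiff_exp.contDiffAt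
  -- Only `r > 0` matters; the cut at `0` gives a function measurable on all of `ℝ`.
  set k : ℝ → ℝ := (Ioi 0).indicator e with hk
  have hke : ∀ r, 0 < r → k r = e r := fun r hr => indicator_of_mem (mem_Ioi.2 hr) _
  -- Since `a q ≥ a₀ m`, integrating `(a q - 1)/ρ` over `(r, 1)` gives `k(r) ≤ r^{a₀ m - 1}` for `r
  -- ≤ 1`. On `[1, R]` the bound follows from compactness.
  refine ⟨k, a₀ * m, by positivity, ?_, ?_, hke, ?_, ?_⟩
  · rw [hk, ← piecewise_eq_indicator]
    exact hek.continuousOn.measurable_piecewise continuousOn_const measurableSet_Ioi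
  · intro r hr
    obtain ⟨K, t, ht, hK⟩ := hek hr
    refine ⟨K, t ∩ Ioi 0, inter_mem ht self_mem_nhdsWithin, fun x hx y hy => ?_⟩
    rw [hke x hx.2, hke y hy.2]
    exact hK hx.1 hy.1
  · filter_upwards [ae_hasDerivAt_primitive hpm hpb] with r hr hr0
    have h1 : HasDerivAt k _ r := (hr hr0).exp.congr_of_eventuallyEq
      ((eventually_gt_nhds hr0).mono fun x hx => hke x hx)
    convert! h1 using 1
    rw [hke r hr0]
    simp only [he, hp]
    ring
  · intro R
    have hcont : ContinuousOn (fun r => k r * r ^ (1 - a₀ * m)) (Icc 1 R) := by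
      have h1 : ContinuousOn k (Icc 1 R) :=
        (hek.continuousOn.congr fun r hr => hke r hr).mono fun r hr => zero_lt_one.trans_le hr.1
      refine h1.mul (continuousOn_id.rpow_const fun r hr => Or.inl ?_)
      exact (zero_lt_one.trans_le hr.1).ne'
    obtain ⟨C, hC⟩ := isCompact_Icc.exists_bound_of_continuousOn hcont
    refine ⟨max 1 C, fun r hr => ?_⟩
    have hr0 := hr.1
    rcases le_total 1 r with h1 | h1
    · have h2 := (le_abs_self _).trans (hC r ⟨h1, hr.2⟩)
      calc k r = k r * r ^ (1 - a₀ * m) * r ^ (a₀ * m - 1) := by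
            rw [mul_assoc, ← Real.rpow_add hr0]; simp
        _ ≤ max 1 C * r ^ (a₀ * m - 1) := by
            gcongr
            exact h2.trans (le_max_right _ _)
    · rw [hke r hr0]
      have hpi := intervalIntegrable_of_locally_bounded hpm hpb hr0 one_pos
      have hci : IntervalIntegrable (fun ρ : ℝ => (a₀ * m - 1) * ρ⁻¹) volume r 1 := by
        refine (intervalIntegral.intervalIntegrable_inv (fun ρ hρ => ?_)
          continuousOn_id).const_mul _
        rw [uIcc_of_le h1] at hρ
        exact (hr0.trans_le hρ.1).ne'
      have h2 : ∫ ρ in r..1, (a₀ * m - 1) * ρ⁻¹ ≤ ∫ ρ in r..1, p ρ := by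
        refine intervalIntegral.integral_mono_on h1 hci hpi fun ρ hρ => ?_
        have hρ0 : 0 < ρ := hr0.trans_le hρ.1
        simp only [hp]
        rw [div_eq_mul_inv]
        gcongr
        · exact (ha₀.trans_le (hal ρ)).le
        · exact hal ρ
        · exact hqm ρ
      rw [intervalIntegral.integral_const_mul, integral_inv_of_pos hr0 one_pos] at h2
      have h3 : ∫ ρ in (1 : ℝ)..r, p ρ ≤ Real.log r * (a₀ * m - 1) := by
        rw [intervalIntegral.integral_symm]
        rw [one_div, Real.log_inv] at h2
        linarith
      calc e r ≤ Real.exp (Real.log r * (a₀ * m - 1)) := Real.exp_le_exp.2 h3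
        _ = r ^ (a₀ * m - 1) := (Real.rpow_def_of_pos hr0 _).symm
        _ ≤ max 1 C * r ^ (a₀ * m - 1) := le_mul_of_one_le_left (by positivity) (le_max_left _ _)

/-- The logarithm of the radial profile is unbounded above near `0`. -/
lemma frequently_lt_integral_profile (hκ : 1 ≤ κ) (ha₀ : 0 < a₀) (ha : Measurable a)
    (hal : ∀ r, a₀ ≤ a r) (hau : ∀ r, a r ≤ a₁) (hm : 0 < m) (hq : Measurable q)
    (hqm : ∀ r, m ≤ q r) (hqM : ∀ r, q r ≤ M) (hqL : LocallyLipschitzOn (Ioi 0) q)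
    (hqd : ∀ᵐ r : ℝ, 0 < r → HasDerivAt q ((κ - (κ - 1) * q r - a r * q r ^ 2) / r) r)
    {b : ℝ → ℝ} (hb : BoundedVariationOn b (Ioo 0 (1 / 2)))
    (hab : ∀ᵐ r : ℝ, r ∈ Ioo 0 (1 / 2) → a r = b r) {g h : ℝ → ℝ} {c : ℝ} (hc : 0 < c)
    (hh : IntegrableOn h (Ioo 0 (1 / 2))) (hgi : ∀ r, 0 < r → r < 1 / 2 →
      IntervalIntegrable (fun ρ => g ρ / ρ) volume r (1 / 2))
    (hgh : ∀ᵐ ρ : ℝ, ρ ∈ Ioo 0 (1 / 2) → c * (g ρ / ρ) - h ρ ≤ (1 - a ρ) / ρ)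
    (hlim : ∀ C : ℝ, ∃ᶠ r in 𝓝[>] 0, C < ∫ s in r..(1 / 2), g s / s) (C : ℝ) :
    ∃ᶠ r in 𝓝[>] 0, C < ∫ ρ in (1 : ℝ)..r, (a ρ * q ρ - 1) / ρ := by
  set p : ℝ → ℝ := fun ρ => (a ρ * q ρ - 1) / ρ with hp
  have hpm : Measurable p := by simp only [hp]; fun_prop
  have hpb : ∀ δ L : ℝ, 0 < δ → ∃ C, ∀ ρ ∈ Icc δ L, |p ρ| ≤ C :=
    abs_mul_sub_one_div_le_of_bounds ha₀ hal hau hm hqm hqM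
  have hpi := fun {x y : ℝ} (hx : 0 < x) (hy : 0 < y) =>
    intervalIntegrable_of_locally_bounded hpm hpb hx hy
  set S : ℝ → ℝ := fun ρ => (κ - (κ - 1) * q ρ - a ρ * q ρ ^ 2) / ρ with hS
  obtain ⟨B, hB⟩ := hb.exists_abs_integral_mul_le
  have hM : 0 ≤ M := hm.le.trans ((hqm 0).trans (hqM 0))
  have hSint : ∀ x y, 0 < x → x ≤ y → IntervalIntegrable S volume x y ∧
      ∫ ρ in x..y, S ρ = q y - q x := by
    intro x y hx hxy
    have hsub : uIcc x y ⊆ Ioi 0 := by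
      rw [uIcc_of_le hxy]; exact fun r hr => hx.trans_le hr.1
    obtain ⟨K, hK⟩ := (hqL.mono hsub).exists_lipschitzOnWith_of_compact isCompact_uIcc
    -- Absolute continuity upgrades the a.e. differential equation to the integrated identity for
    -- `q`.
    have hac := hK.absolutelyContinuousOnInterval
    have hd : ∀ᵐ r ∂(volume.restrict (uIoc x y)), deriv q r = S r := by
      rw [ae_restrict_iff' measurableSet_uIoc]
      filter_upwards [hqd] with r hr hrm
      exact (hr (hsub (uIoc_subset_uIcc hrm))).deriv
    refine ⟨hac.intervalIntegrable_deriv.congr_ae hd, ?_⟩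
    rw [← hac.integral_deriv_eq_sub]
    exact intervalIntegral.integral_congr_ae_restrict (hd.mono fun r hr => hr.symm)
  set H := ∫ ρ in Ioo 0 (1 / 2), |h ρ| with hH
  have hlow : ∀ r ∈ Ioo (0 : ℝ) (1 / 2), (κ * c * (∫ s in r..(1 / 2), g s / s) - κ * H - B * (2 * M))
      ≤ (κ + 1) * ((∫ ρ in (1 : ℝ)..r, p ρ) - ∫ ρ in (1 : ℝ)..(1 / 2), p ρ) := by
    intro r hr
    have hr0 := hr.1
    have hrle := hr.2.le
    have hne : ∀ᵐ ρ : ℝ, ρ ≠ 1 / 2 := by simp [ae_iff, measure_singleton]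
    have hmem : ∀ ρ ∈ Icc r (1 / 2), ρ ≠ 1 / 2 → ρ ∈ Ioo (0 : ℝ) (1 / 2) := fun ρ hρ hρ' =>
      ⟨hr0.trans_le hρ.1, lt_of_le_of_ne hρ.2 hρ'⟩
    have hhi : IntervalIntegrable h volume r (1 / 2) := by
      rw [intervalIntegrable_iff_integrableOn_Ioo_of_le hrle]
      exact hh.mono_set (Ioo_subset_Ioo_left hr0.le)
    have hSr := hSint r (1 / 2) hr0 hrle
    have haS : IntervalIntegrable (fun ρ => a ρ * S ρ) volume r (1 / 2) := by
      rw [intervalIntegrable_iff] at hSr ⊢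
      refine Integrable.bdd_mul (c := a₁) hSr.1 ha.aestronglyMeasurable
        (Eventually.of_forall fun ρ => ?_)
      rw [Real.norm_eq_abs, abs_of_nonneg (ha₀.le.trans (hal ρ))]
      exact hau ρ
    -- Bounded variation enters here: `S = q'` a.e., so its terminal integrals are differences of
    -- values of `q`, at most `2M` in absolute value. Hence `∫ a q'` is bounded uniformly in `r`,
    -- although `q'` need not be integrable up to `0`.
    have hBS : -(B * (2 * M)) ≤ ∫ ρ in r..(1 / 2), a ρ * S ρ := by
      have h1 := hB S r (2 * M) hr hSr.1 fun x hx => by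
        rw [(hSint x (1 / 2) (hr0.trans_le hx.1) hx.2).2, abs_le]
        have := hqm x; have := hqM x; have := hqm (1 / 2); have := hqM (1 / 2)
        constructor <;> linarith
      have h2 : ∫ ρ in r..(1 / 2), a ρ * S ρ = ∫ ρ in r..(1 / 2), b ρ * S ρ := by
        apply intervalIntegral.integral_congr_ae
        filter_upwards [hab, hne] with ρ hρ hρ' hρm
        rw [uIoc_of_le hrle] at hρm
        rw [hρ (hmem ρ (Ioc_subset_Icc_self hρm) hρ')]
      rw [h2]
      exact (abs_le.1 h1).1
    have hHr : ∫ ρ in r..(1 / 2), h ρ ≤ H := by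
      rw [intervalIntegral.integral_of_le hrle, integral_Ioc_eq_integral_Ioo]
      calc ∫ ρ in Ioo r (1 / 2), h ρ ≤ ∫ ρ in Ioo r (1 / 2), |h ρ| :=
            integral_mono (hh.mono_set (Ioo_subset_Ioo_left hr0.le))
              (hh.mono_set (Ioo_subset_Ioo_left hr0.le)).abs fun ρ => le_abs_self _
        _ ≤ H := setIntegral_mono_set hh.abs (Eventually.of_forall fun ρ => abs_nonneg _)
            (Ioo_subset_Ioo_left hr0.le).eventuallyLE
    have hkey : ∫ ρ in r..(1 / 2), (a ρ * S ρ + κ * (c * (g ρ / ρ) - h ρ)) ≤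
        ∫ ρ in r..(1 / 2), (κ + 1) * (-p ρ) := by
      refine intervalIntegral.integral_mono_ae_restrict hrle
        (haS.add ((((hgi r hr0 hr.2).const_mul c).sub hhi).const_mul κ))
        ((hpi hr0 (by norm_num)).neg.const_mul _) ?_
      rw [Filter.EventuallyLE, ae_restrict_iff' measurableSet_Icc]
      filter_upwards [hgh, hne] with ρ hρ hρ' hρm
      have hρI := hmem ρ hρm hρ'
      have hρ0 := hρI.1
      -- Completing the square in `1 - a q`. The square has a favourable sign and is dropped, so no
      -- estimate of `a q - 1` is required.
      have h1 : a ρ * S ρ + κ * ((1 - a ρ) / ρ) = (κ + 1) * (-p ρ) - (1 - a ρ * q ρ) ^ 2 / ρ := by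
        simp only [hS, hp]
        field_simp
        ring
      have h2 : 0 ≤ (1 - a ρ * q ρ) ^ 2 / ρ := by positivity
      have h3 := mul_le_mul_of_nonneg_left (hρ hρI) (by linarith : 0 ≤ κ)
      linarith
    rw [intervalIntegral.integral_add haS
      ((((hgi r hr0 hr.2).const_mul c).sub hhi).const_mul κ), intervalIntegral.integral_const_mul,
      intervalIntegral.integral_sub ((hgi r hr0 hr.2).const_mul c) hhi,
      intervalIntegral.integral_const_mul, intervalIntegral.integral_const_mul,
      intervalIntegral.integral_neg] at hkey
    rw [intervalIntegral.integral_interval_sub_left (hpi one_pos hr0) (hpi one_pos (by norm_num)),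
      intervalIntegral.integral_symm r (1 / 2)]
    have h4 := mul_le_mul_of_nonneg_left hHr (by linarith : 0 ≤ κ)
    linarith
  set c₁ := ∫ ρ in (1 : ℝ)..(1 / 2), p ρ with hc₁
  have hκc : 0 < κ * c := by positivity
  have hf := hlim (((κ + 1) * (C - c₁) + κ * H + B * (2 * M)) / (κ * c))
  have hev : ∀ᶠ r in 𝓝[>] (0 : ℝ), r ∈ Ioo (0 : ℝ) (1 / 2) := Ioo_mem_nhdsGT (by norm_num)
  refine (hf.and_eventually hev).mono fun r hr => ?_
  have h1 := hlow r hr.2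
  have h2 := hr.1
  rw [div_lt_iff₀ hκc] at h2
  have h3 : (κ + 1) * (C - c₁) < (κ + 1) * ((∫ ρ in (1 : ℝ)..r, p ρ) - c₁) := by linarith
  have h4 := lt_of_mul_lt_mul_left h3 (by linarith)
  linarith

end Profile

/-! ### Integrability of radial powers and calculus for the flux. -/

section Flux

variable {n : ℕ}

/-- A null set of radii yields a null set of points. -/
lemma ae_norm_of_ae {P : ℝ → Prop} (hn : 2 ≤ n) (hP : ∀ᵐ r : ℝ, 0 < r → P r) :
    ∀ᵐ x : Eu n, x ≠ 0 → P ‖x‖ := by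
  have : Nonempty (Fin n) := ⟨⟨0, by omega⟩⟩
  -- A measurable null hull of the bad radii allows integration of its indicator in polar
  -- coordinates, where the integral vanishes.
  set N := toMeasurable volume {r : ℝ | ¬ (0 < r → P r)} with hN
  have hN0 : volume N = 0 := by rw [hN, measure_toMeasurable]; exact ae_iff.1 hP
  have hzero : (fun y : ℝ => y ^ (Module.finrank ℝ (Eu n) - 1) • N.indicator (fun _ => (1 : ℝ)) y)
      =ᵐ[volume.restrict (Ioi 0)] 0 := by
    refine ae_restrict_of_ae ?_
    filter_upwards [measure_eq_zero_iff_ae_notMem.1 hN0] with y hy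
    simp [indicator_of_notMem hy]
  have hint : Integrable (fun x : Eu n => N.indicator (fun _ => (1 : ℝ)) ‖x‖) := by
    rw [integrable_fun_norm_addHaar volume (f := N.indicator (fun _ => (1 : ℝ)))]
    exact (integrable_zero _ _ _).congr hzero.symm
  have hval : ∫ x : Eu n, N.indicator (fun _ => (1 : ℝ)) ‖x‖ = 0 := by
    rw [integral_fun_norm_addHaar volume (N.indicator (fun _ => (1 : ℝ))), integral_congr_ae hzero]
    simp
  rw [integral_eq_zero_iff_of_nonneg
    (fun x => indicator_nonneg (fun _ _ => zero_le_one) _) hint] at hval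
  filter_upwards [hval] with x hx hx0
  have hxN : ‖x‖ ∉ N := by
    intro h
    simp [indicator_of_mem h] at hx
  by_contra h
  exact hxN (subset_toMeasurable _ _ fun h' => h (h' (norm_pos_iff.2 hx0)))

/-- In polar coordinates the integrand is `r^{n-1+s}`, and `n - 1 + s > -1`; dimension two is the
critical case. -/
lemma integrableOn_norm_rpow (hn : 2 ≤ n) {s : ℝ} (hs : -2 < s) (R : ℝ) :
    IntegrableOn (fun x : Eu n => ‖x‖ ^ s) (Metric.ball 0 R) := by
  have : Nonempty (Fin n) := ⟨⟨0, by omega⟩⟩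
  rcases le_or_gt R 0 with hR | hR
  · simp [Metric.ball_eq_empty.2 hR]
  rw [integrableOn_fun_norm_addHaar volume (f := fun r : ℝ => r ^ s)]
  have h1 : IntegrableOn (fun y : ℝ => y ^ ((n : ℝ) - 1 + s)) (Ioo 0 R) := by
    rw [intervalIntegral.integrableOn_Ioo_rpow_iff hR]
    have : (2 : ℝ) ≤ n := by exact_mod_cast hn
    linarith
  refine h1.congr_fun (fun y hy => ?_) measurableSet_Ioo
  have hy0 : 0 < y := hy.1
  simp only [finrank_euclideanSpace, Fintype.card_fin, smul_eq_mul]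
  rw [Real.rpow_add hy0, ← Real.rpow_natCast, Nat.cast_sub (by omega), Nat.cast_one]

lemma ae_ne_zero_mem_ball (hn : 2 ≤ n) (R : ℝ) :
    ∀ᵐ x ∂(volume.restrict (Metric.ball (0 : Eu n) R)), x ≠ 0 ∧ x ∈ Metric.ball (0 : Eu n) R := by
  have : Nonempty (Fin n) := ⟨⟨0, by omega⟩⟩
  have h1 : ∀ᵐ x ∂(volume.restrict (Metric.ball (0 : Eu n) R)), x ≠ 0 :=
    ae_restrict_of_ae (by simp [ae_iff, measure_singleton])
  exact h1.and (ae_restrict_mem measurableSet_ball)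

lemma integrableOn_ball_of_norm_le {F' : Type*} [NormedAddCommGroup F'] (hn : 2 ≤ n) {R C s : ℝ}
    (hs : -2 < s) {f : Eu n → F'} (hf : AEStronglyMeasurable f)
    (hb : ∀ x ∈ Metric.ball (0 : Eu n) R, x ≠ 0 → ‖f x‖ ≤ C * ‖x‖ ^ s) :
    IntegrableOn f (Metric.ball 0 R) := by
  refine ((integrableOn_norm_rpow hn hs R).const_mul C).mono' hf.restrict ?_
  filter_upwards [ae_ne_zero_mem_ball hn R] with x hx using hb x hx.2 hx.1

lemma memLp_two_ball_of_norm_le {F' : Type*} [NormedAddCommGroup F'] (hn : 2 ≤ n) {R C s : ℝ}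
    (hs : -1 < s) {f : Eu n → F'} (hf : AEStronglyMeasurable f)
    (hb : ∀ x ∈ Metric.ball (0 : Eu n) R, x ≠ 0 → ‖f x‖ ≤ C * ‖x‖ ^ s) :
    MemLp f 2 (volume.restrict (Metric.ball 0 R)) := by
  rw [memLp_two_iff_integrable_sq_norm hf.restrict]
  refine integrableOn_ball_of_norm_le (C := C ^ 2) (s := 2 * s) hn (by linarith) (hf.norm.pow 2)
    fun x hx hx0 => ?_
  have hx' : 0 < ‖x‖ := norm_pos_iff.2 hx0
  rw [norm_pow, norm_norm, mul_comm 2 s, Real.rpow_mul hx'.le, Real.rpow_two, ← mul_pow]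
  exact pow_le_pow_left₀ (norm_nonneg _) (hb x hx hx0) 2

lemma HasLineDerivAt.mul_real {f g : Eu n → ℝ} {f' g' : ℝ} {x v : Eu n}
    (hf : HasLineDerivAt ℝ f f' x v) (hg : HasLineDerivAt ℝ g g' x v) :
    HasLineDerivAt ℝ (fun y => f y * g y) (f' * g x + f x * g') x v := by
  change HasDerivAt (fun t : ℝ => f (x + t • v) * g (x + t • v)) _ 0
  simpa using HasDerivAt.fun_mul hf hg

lemma HasLineDerivAt.add_real {f g : Eu n → ℝ} {f' g' : ℝ} {x v : Eu n}
    (hf : HasLineDerivAt ℝ f f' x v) (hg : HasLineDerivAt ℝ g g' x v) :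
    HasLineDerivAt ℝ (fun y => f y + g y) (f' + g') x v :=
  HasDerivAt.add hf hg

lemma LocallyLipschitzOn.comp_norm {k : ℝ → ℝ} (hk : LocallyLipschitzOn (Ioi 0) k) :
    LocallyLipschitzOn ({0}ᶜ : Set (Eu n)) fun x => k ‖x‖ := by
  intro x hx
  obtain ⟨K, t, ht, hK⟩ := hk (norm_pos_iff.2 hx : ‖x‖ ∈ Ioi (0 : ℝ))
  refine ⟨K * 1, (fun y : Eu n => ‖y‖) ⁻¹' t, ?_, hK.comp lipschitzWith_one_norm.lipschitzOnWith
    fun y hy => hy⟩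
  refine mem_nhdsWithin_of_mem_nhds (continuous_norm.continuousAt ?_)
  rwa [nhdsWithin_eq_nhds.2 (isOpen_Ioi.mem_nhds (norm_pos_iff.2 hx))] at ht

lemma abs_coord_le (x : Eu n) (i : Fin n) : |x i| ≤ ‖x‖ := PiLp.norm_apply_le x i

/-- Bound on a combination of the quantities `p x_i x_j` and `c k`. -/
lemma norm_mul_coord_add_le {x : Eu n} {i j : Fin n} {p k δ A : ℝ} (hδ : |δ| ≤ 1)
    (hp : |p| * ‖x‖ ^ 2 ≤ A) (hk : |k| ≤ A) : ‖p * (x i * x j) + δ * k‖ ≤ 2 * A := by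
  refine (norm_add_le _ _).trans ?_
  have h1 : ‖p * (x i * x j)‖ ≤ A := by
    rw [Real.norm_eq_abs, abs_mul, abs_mul]
    refine le_trans ?_ hp
    rw [pow_two]
    gcongr
    · exact abs_coord_le x i
    · exact abs_coord_le x j
  have h2 : ‖δ * k‖ ≤ A := by
    rw [norm_mul]
    exact (mul_le_of_le_one_left (norm_nonneg _) hδ).trans hk
  linarith

/-- The line derivative of `x ↦ l(|x|) x_i x_j + δ k(|x|)`. -/
lemma hasLineDerivAt_flux {l k : ℝ → ℝ} {l' k' : ℝ} {x : Eu n} (hx : x ≠ 0)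
    (hl : HasDerivAt l l' ‖x‖) (hk : HasDerivAt k k' ‖x‖) (i₀ j : Fin n) :
    HasLineDerivAt ℝ (fun x : Eu n => l ‖x‖ * (x i₀ * x j) + (if i₀ = j then 1 else 0) * k ‖x‖)
      (l' / ‖x‖ * x j * (x i₀ * x j) + l ‖x‖ * ((if i₀ = j then x j else 0) + x i₀) +
        (if i₀ = j then 1 else 0) * (k' / ‖x‖ * x j)) x (EuclideanSpace.single j 1) := by
  have h1 := (hl.hasLineDerivAt_comp_norm hx j).mul_real
    ((hasLineDerivAt_coord j i₀ x).mul_real (hasLineDerivAt_coord j j x))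
  have h2 : HasLineDerivAt ℝ (fun _ : Eu n => (if i₀ = j then 1 else 0 : ℝ)) 0 x
      (EuclideanSpace.single j 1) := by
    simpa [HasLineDerivAt] using hasDerivAt_const (0 : ℝ) (if i₀ = j then 1 else 0 : ℝ)
  have h3 := h1.add_real (h2.mul_real (hk.hasLineDerivAt_comp_norm hx j))
  convert! h3 using 1
  by_cases h : i₀ = j <;> simp [h, eq_comm]

lemma sum_flux_divergence (x : Eu n) (i₀ : Fin n) (l l' k' : ℝ) :
    ∑ j, (l' / ‖x‖ * x j * (x i₀ * x j) + l * ((if i₀ = j then x j else 0) + x i₀) +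
        (if i₀ = j then 1 else 0) * (k' / ‖x‖ * x j)) =
      x i₀ * (l' / ‖x‖ * ‖x‖ ^ 2 + (n + 1) * l + k' / ‖x‖) := by
  rw [← sum_coord_sq x, Finset.sum_add_distrib, Finset.sum_add_distrib, ← Finset.mul_sum,
    Finset.sum_add_distrib]
  have h1 : ∑ j, l' / ‖x‖ * x j * (x i₀ * x j) = x i₀ * (l' / ‖x‖ * ∑ j, x j ^ 2) := by
    rw [Finset.mul_sum, Finset.mul_sum]
    exact Finset.sum_congr rfl fun j _ => by ring
  rw [h1]
  simp
  ring

/-- The gradient of `u` may jump with `g`, but the flux, written through `q` and `k`, is locally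
Lipschitz away from `0` and can be differentiated a.e. -/
lemma locallyLipschitzOn_flux {l k : ℝ → ℝ} (hl : LocallyLipschitzOn (Ioi 0) l)
    (hk : LocallyLipschitzOn (Ioi 0) k) (i₀ j : Fin n) (δ : ℝ) :
    LocallyLipschitzOn ({0}ᶜ : Set (Eu n)) fun x => l ‖x‖ * (x i₀ * x j) + δ * k ‖x‖ := by
  have h1 : LocallyLipschitzOn ({0}ᶜ : Set (Eu n)) fun x => ((l ‖x‖, k ‖x‖), x) :=
    (hl.comp_norm.prodMk_mk hk.comp_norm).prodMk_mk LocallyLipschitz.id.locallyLipschitzOn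
  have hc : ∀ i : Fin n, ContDiff ℝ 1 fun z : (ℝ × ℝ) × Eu n => z.2 i := fun i =>
    (EuclideanSpace.proj i : Eu n →L[ℝ] ℝ).contDiff.comp contDiff_snd
  refine h1.contDiffAt_comp (Φ := fun z : (ℝ × ℝ) × Eu n => z.1.1 * (z.2 i₀ * z.2 j) + δ * z.1.2)
    fun x _ => ContDiff.contDiffAt ?_
  exact (contDiff_fst.fst.mul ((hc i₀).mul (hc j))).add (contDiff_const.mul contDiff_fst.snd)

lemma locallyLipschitzOn_comp_norm_mul_coord {k : ℝ → ℝ}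
    (hk : LocallyLipschitzOn (Ioi 0) k) (i₀ : Fin n) :
    LocallyLipschitzOn ({0}ᶜ : Set (Eu n)) fun x => k ‖x‖ * x i₀ := by
  have h1 : LocallyLipschitzOn ({0}ᶜ : Set (Eu n)) fun x => (k ‖x‖, x) :=
    hk.comp_norm.prodMk_mk LocallyLipschitz.id.locallyLipschitzOn
  refine h1.contDiffAt_comp (Φ := fun z : ℝ × Eu n => z.1 * z.2 i₀) fun x _ =>
    ContDiff.contDiffAt ?_
  exact contDiff_fst.mul ((EuclideanSpace.proj i₀ : Eu n →L[ℝ] ℝ).contDiff.comp contDiff_snd)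

end Flux

/-! ### From the radial equation to the weak equation. -/

section WeakSolution

variable {n : ℕ}

/-- The Gilbarg-Serrin matrix applied to the gradient of a function `k(|x|) x_{i₀}`. -/
lemma sum_gsCoeff_mul {g : ℝ → ℝ} {x : Eu n} (hx : x ≠ 0) (i₀ j : Fin n) (c k : ℝ) :
    ∑ i, gsCoeff g x i j * (c * (x i₀ * x i) + (if i₀ = i then 1 else 0) * k) =
      (c * (1 + g ‖x‖) + g ‖x‖ * k / ‖x‖ ^ 2) * (x i₀ * x j) + (if i₀ = j then 1 else 0) * k := by
  have hx0 : ‖x‖ ≠ 0 := norm_ne_zero_iff.2 hx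
  have h1 : ∀ i, gsCoeff g x i j * (c * (x i₀ * x i) + (if i₀ = i then 1 else 0) * k) =
      (if i = j then c * (x i₀ * x i) + (if i₀ = i then 1 else 0) * k else 0) +
      (g ‖x‖ * c * x i₀ * x j / ‖x‖ ^ 2) * x i ^ 2 +
      (if i₀ = i then g ‖x‖ * k * x i * x j / ‖x‖ ^ 2 else 0) := by
    intro i
    simp only [gsCoeff]
    split_ifs <;> field_simp <;> ring
  simp_rw [h1]
  rw [Finset.sum_add_distrib, Finset.sum_add_distrib, ← Finset.mul_sum, sum_coord_sq]
  simp
  field_simp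
  ring

/-- A radial profile solving the radial equation yields a weak solution. -/
lemma isWeakSolution_radial (hn : 2 ≤ n) (i₀ : Fin n) {R a₀ a₁ m M β C : ℝ} {g a q k : ℝ → ℝ}
    (ha₀ : 0 < a₀) (ha : Measurable a) (hal : ∀ r, a₀ ≤ a r) (hau : ∀ r, a r ≤ a₁) (hm : 0 < m)
    (hq : Measurable q) (hqm : ∀ r, m ≤ q r) (hqM : ∀ r, q r ≤ M)
    (hqL : LocallyLipschitzOn (Ioi 0) q)
    (hqd : ∀ᵐ r : ℝ, 0 < r →
      HasDerivAt q (((n : ℝ) - 1 - ((n : ℝ) - 1 - 1) * q r - a r * q r ^ 2) / r) r)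
    (hβ : 0 < β) (hk : Measurable k) (hk0 : ∀ r, 0 < r → 0 ≤ k r)
    (hkL : LocallyLipschitzOn (Ioi 0) k)
    (hkd : ∀ᵐ r : ℝ, 0 < r → HasDerivAt k ((a r * q r - 1) * k r / r) r)
    (hkC : ∀ r ∈ Ioc 0 R, k r ≤ C * r ^ (β - 1))
    (hga : ∀ᵐ r : ℝ, r ∈ Ioo 0 R → a r * (1 + g r) = 1) :
    IsWeakSolution (gsCoeff g) (Metric.ball 0 R) (fun x : Eu n => k ‖x‖ * x i₀) := by
  have hn1 : (2 : ℝ) ≤ n := by exact_mod_cast hn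
  set kd : ℝ → ℝ := fun r => (a r * q r - 1) * k r / r with hkd_def
  set S : ℝ → ℝ := fun r => ((n : ℝ) - 1 - ((n : ℝ) - 1 - 1) * q r - a r * q r ^ 2) / r with hS
  -- The flux of `u = k x_{i₀}` is `l x_{i₀} x + k e_{i₀}`: the radial coefficient `(1+g) k'/r + g
  -- k/r²` reduces to `(q-1) k/r²` because `a(1+g) = 1`. Below, `kd` and `ld` are the a.e.
  -- derivatives of `k` and `l`.
  set l : ℝ → ℝ := fun r => (q r - 1) * k r / r ^ 2 with hl_def
  set ld : ℝ → ℝ := fun r =>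
    ((S r * k r + (q r - 1) * kd r) * r ^ 2 - (q r - 1) * k r * (2 * r)) / (r ^ 2) ^ 2 with hld_def
  have hkdm : Measurable kd := by simp only [hkd_def]; fun_prop
  have hlm : Measurable l := by simp only [hl_def]; fun_prop
  have hldm : Measurable ld := by simp only [hld_def, hS]; fun_prop
  have hld : ∀ᵐ r : ℝ, 0 < r → HasDerivAt l (ld r) r := by
    filter_upwards [hqd, hkd] with r hr1 hr2 hr0
    have := (((hr1 hr0).sub_const 1).fun_mul (hr2 hr0)).fun_div (hasDerivAt_pow 2 r)
      (pow_ne_zero 2 hr0.ne')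
    convert! this using 1
    simp [hld_def, hS, hkd_def]
  have hlL : LocallyLipschitzOn (Ioi 0) l := by
    have h1 : LocallyLipschitzOn (Ioi 0) fun r => ((q r, k r), r) :=
      (hqL.prodMk_mk hkL).prodMk_mk LocallyLipschitz.id.locallyLipschitzOn
    refine h1.contDiffAt_comp (Φ := fun z : (ℝ × ℝ) × ℝ => (z.1.1 - 1) * z.1.2 / z.2 ^ 2)
      fun r hr => ?_
    exact ((contDiff_fst.fst.sub contDiff_const).mul contDiff_fst.snd).contDiffAt.div
      (contDiff_snd.pow 2).contDiffAt (pow_ne_zero 2 (ne_of_gt hr))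
  -- pointwise bounds in terms of `k`
  have ha₁ : 0 < a₁ := ha₀.trans_le ((hal 0).trans (hau 0))
  have hM : 0 < M := hm.trans_le ((hqm 0).trans (hqM 0))
  set A₁ := a₁ * M + 1 with hA₁
  set A₂ := M + 1 with hA₂
  set A₃ := (n : ℝ) + n * M + a₁ * M ^ 2 with hA₃
  have b1 : ∀ r, |a r * q r - 1| ≤ A₁ := by
    intro r
    have hq0 : 0 ≤ q r := hm.le.trans (hqm r)
    have h1 : a r * q r ≤ a₁ * M := mul_le_mul (hau r) (hqM r) hq0 ha₁.le
    have h2 : 0 ≤ a r * q r := mul_nonneg (ha₀.le.trans (hal r)) hq0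
    rw [abs_le]; constructor <;> linarith
  have b2 : ∀ r, |q r - 1| ≤ A₂ := by
    intro r
    have := hqm r; have := hqM r
    rw [abs_le]; constructor <;> linarith
  have b3 : ∀ r, |(n : ℝ) - 1 - ((n : ℝ) - 1 - 1) * q r - a r * q r ^ 2| ≤ A₃ := by
    intro r
    have hq0 : 0 ≤ q r := hm.le.trans (hqm r)
    have h1 : a r * q r ^ 2 ≤ a₁ * M ^ 2 :=
      mul_le_mul (hau r) (pow_le_pow_left₀ hq0 (hqM r) 2) (by positivity) ha₁.le
    have h2 : 0 ≤ a r * q r ^ 2 := mul_nonneg (ha₀.le.trans (hal r)) (by positivity)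
    have h3 : ((n : ℝ) - 1 - 1) * q r ≤ n * M :=
      mul_le_mul (by linarith) (hqM r) hq0 (by positivity)
    have h4 : 0 ≤ ((n : ℝ) - 1 - 1) * q r := mul_nonneg (by linarith) hq0
    rw [abs_le]; constructor <;> linarith
  have hA₁0 : 0 ≤ A₁ := by positivity
  have hA₂0 : 0 ≤ A₂ := by positivity
  have hA₃0 : 0 ≤ A₃ := by positivity
  -- A single constant serving for `k`, `r k'`, `r² l` and `r³ l'`, each bounded by `A k`.
  set A := 1 + A₁ + A₃ + A₂ * A₁ + 3 * A₂ with hA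
  have hA₂₁ : 0 ≤ A₂ * A₁ := by positivity
  have hkdb : ∀ r, 0 < r → |kd r| * r ≤ A * k r := by
    intro r hr
    have h0 := hk0 r hr
    rw [hkd_def]
    simp only
    rw [abs_div, abs_mul, abs_of_nonneg h0, abs_of_pos hr, div_mul_cancel₀ _ hr.ne']
    exact mul_le_mul_of_nonneg_right ((b1 r).trans (by linarith)) h0
  have hlb : ∀ r, 0 < r → |l r| * r ^ 2 ≤ A * k r := by
    intro r hr
    have h0 := hk0 r hr
    have hr2 : 0 < r ^ 2 := by positivity
    rw [hl_def]
    simp only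
    rw [abs_div, abs_mul, abs_of_nonneg h0, abs_of_pos hr2, div_mul_cancel₀ _ hr2.ne']
    exact mul_le_mul_of_nonneg_right ((b2 r).trans (by linarith)) h0
  have hldb : ∀ r, 0 < r → |ld r| * r ^ 3 ≤ A * k r := by
    intro r hr
    have h0 := hk0 r hr
    have hr3 : 0 < r ^ 3 := by positivity
    have h1 : ld r * r ^ 3 = (((n : ℝ) - 1 - ((n : ℝ) - 1 - 1) * q r - a r * q r ^ 2) +
        (q r - 1) * (a r * q r - 1) - 2 * (q r - 1)) * k r := by
      simp only [hld_def, hS, hkd_def]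
      field_simp
    rw [← abs_of_pos hr3, ← abs_mul, h1, abs_mul, abs_of_nonneg h0]
    refine mul_le_mul_of_nonneg_right ?_ h0
    refine (abs_sub _ _).trans ?_
    have h2 := abs_add_le ((n : ℝ) - 1 - ((n : ℝ) - 1 - 1) * q r - a r * q r ^ 2)
      ((q r - 1) * (a r * q r - 1))
    have h3 : |(q r - 1) * (a r * q r - 1)| ≤ A₂ * A₁ := by
      rw [abs_mul]; exact mul_le_mul (b2 r) (b1 r) (abs_nonneg _) hA₂0
    have h4 : |2 * (q r - 1)| ≤ 2 * A₂ := by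
      rw [abs_mul, abs_two]; linarith [b2 r]
    linarith [b3 r]
  have hA1 : 1 ≤ A := by linarith
  have hkA : ∀ r, 0 < r → |k r| ≤ A * k r := by
    intro r hr
    rw [abs_of_nonneg (hk0 r hr)]
    exact le_mul_of_one_le_left (hk0 r hr) hA1
  have hball : ∀ x ∈ Metric.ball (0 : Eu n) R, x ≠ 0 →
      0 < ‖x‖ ∧ A * k ‖x‖ ≤ A * C * ‖x‖ ^ (β - 1) := by
    intro x hx hx0
    have hx' : 0 < ‖x‖ := norm_pos_iff.2 hx0
    refine ⟨hx', ?_⟩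
    rw [mul_assoc]
    exact mul_le_mul_of_nonneg_left (hkC _ ⟨hx', (mem_ball_zero_iff.1 hx).le⟩) (by linarith)
  have hrpow : ∀ r : ℝ, 0 < r → r ^ (β - 1) / r = r ^ (β - 2) := by
    intro r hr
    rw [div_eq_mul_inv, ← Real.rpow_neg_one r, ← Real.rpow_add hr]
    ring_nf
  have hδ : ∀ j : Fin n, |(if i₀ = j then 1 else 0 : ℝ)| ≤ 1 := by
    intro j; split_ifs <;> simp
  have hcoord : ∀ i : Fin n, Measurable fun x : Eu n => x i := fun i =>
    (EuclideanSpace.proj i : Eu n →L[ℝ] ℝ).continuous.measurable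
  -- the gradient
  set G : Eu n → Eu n := fun x =>
    (kd ‖x‖ / ‖x‖ * x i₀) • x + k ‖x‖ • EuclideanSpace.single i₀ (1 : ℝ) with hG
  have hGi : ∀ x i, G x i = kd ‖x‖ / ‖x‖ * (x i₀ * x i) + (if i₀ = i then 1 else 0) * k ‖x‖ := by
    intro x i
    simp only [hG, PiLp.add_apply, PiLp.smul_apply, smul_eq_mul, PiLp.single_apply]
    by_cases h : i₀ = i
    · simp [h]; ring
    · simp [h, Ne.symm h]; ring
  have hkdx : ∀ x : Eu n, x ≠ 0 → |kd ‖x‖ / ‖x‖| * ‖x‖ ^ 2 ≤ A * k ‖x‖ := by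
    intro x hx
    have hx' : 0 < ‖x‖ := norm_pos_iff.2 hx
    refine le_trans (le_of_eq ?_) (hkdb _ hx')
    rw [abs_div, abs_of_pos hx']
    field_simp
  have hGm : Measurable G := by
    have := hcoord i₀
    simp only [hG]
    fun_prop
  have hGb : ∀ x ∈ Metric.ball (0 : Eu n) R, x ≠ 0 → ‖G x‖ ≤ 2 * A * C * ‖x‖ ^ (β - 1) := by
    intro x hx hx0
    obtain ⟨hx', hb⟩ := hball x hx hx0
    have h1 : ‖(kd ‖x‖ / ‖x‖ * x i₀) • x‖ ≤ A * k ‖x‖ := by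
      refine le_trans ?_ (hkdx x hx0)
      rw [norm_smul, Real.norm_eq_abs, abs_mul, mul_assoc, pow_two]
      gcongr
      exact abs_coord_le x i₀
    have h2 : ‖k ‖x‖ • EuclideanSpace.single i₀ (1 : ℝ)‖ ≤ A * k ‖x‖ := by
      rw [norm_smul, PiLp.norm_single, norm_one, mul_one]
      exact hkA _ hx'
    have := norm_add_le ((kd ‖x‖ / ‖x‖ * x i₀) • x) (k ‖x‖ • EuclideanSpace.single i₀ (1 : ℝ))
    simp only [hG]
    linarith
  have hGii : ∀ i, IntegrableOn (fun x => G x i) (Metric.ball 0 R) := fun i =>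
    integrableOn_ball_of_norm_le (s := β - 1) hn (by linarith)
      ((hcoord i).comp hGm).aestronglyMeasurable
      fun x hx hx0 => (PiLp.norm_apply_le (G x) i).trans (hGb x hx hx0)
  have hub : ∀ x ∈ Metric.ball (0 : Eu n) R, x ≠ 0 →
      ‖k ‖x‖ * x i₀‖ ≤ A * C * ‖x‖ ^ (β - 1) * ‖x‖ := by
    intro x hx hx0
    obtain ⟨hx', hb⟩ := hball x hx hx0
    rw [norm_mul]
    exact mul_le_mul ((hkA _ hx').trans hb) (abs_coord_le x i₀) (norm_nonneg _)
      ((abs_nonneg _).trans ((hkA _ hx').trans hb))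
  have hum : Measurable fun x : Eu n => k ‖x‖ * x i₀ := by
    have := hcoord i₀
    fun_prop
  refine ⟨G, ⟨?_, ?_, ?_⟩, ?_⟩
  · refine memLp_two_ball_of_norm_le (C := A * C) (s := β) hn (by linarith)
      hum.aestronglyMeasurable fun x hx hx0 => (hub x hx hx0).trans (le_of_eq ?_)
    rw [mul_assoc, ← Real.rpow_add_one (norm_ne_zero_iff.2 hx0)]
    ring_nf
  · exact memLp_two_ball_of_norm_le hn (by linarith) hGm.aestronglyMeasurable hGb
  · intro φ hφ i
    refine setIntegral_mul_pderiv_of_locallyLipschitzOn i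
      (locallyLipschitzOn_comp_norm_mul_coord hkL i₀) ?_ ?_ (hGii i) hφ
    · filter_upwards [ae_norm_of_ae hn hkd] with x hx hx0
      convert! ((hx hx0).hasLineDerivAt_comp_norm hx0 i).mul_real
        (hasLineDerivAt_coord i i₀ x) using 1
      rw [hGi]
      by_cases h : i₀ = i
      · simp [h]; ring
      · simp [h, Ne.symm h]; ring
    · refine integrableOn_ball_of_norm_le (C := A * C) (s := β - 1) hn (by linarith)
        (hum.div measurable_norm).aestronglyMeasurable fun x hx hx0 => ?_
      rw [norm_div, norm_norm, div_le_iff₀ (norm_pos_iff.2 hx0)]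
      exact hub x hx hx0
  · intro φ hφ
    -- the flux
    set F : Fin n → Eu n → ℝ := fun j x =>
      l ‖x‖ * (x i₀ * x j) + (if i₀ = j then 1 else 0) * k ‖x‖ with hF
    set D : Fin n → Eu n → ℝ := fun j x =>
      ld ‖x‖ / ‖x‖ * x j * (x i₀ * x j) + l ‖x‖ * ((if i₀ = j then x j else 0) + x i₀) +
        (if i₀ = j then 1 else 0) * (kd ‖x‖ / ‖x‖ * x j) with hD
    have hFm : ∀ j, Measurable (F j) := by
      intro j
      have := hcoord i₀
      have := hcoord j
      simp only [hF]
      fun_prop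
    have hDm : ∀ j, Measurable (D j) := by
      intro j
      have h1 := hcoord i₀
      have h2 := hcoord j
      have h3 : Measurable fun x : Eu n => (if i₀ = j then x j else 0) := by
        split_ifs
        · exact h2
        · exact measurable_const
      simp only [hD]
      fun_prop
    have hFb : ∀ j, ∀ x ∈ Metric.ball (0 : Eu n) R, x ≠ 0 →
        ‖F j x‖ ≤ 2 * A * C * ‖x‖ ^ (β - 1) := by
      intro j x hx hx0
      obtain ⟨hx', hb⟩ := hball x hx hx0
      have := norm_mul_coord_add_le (i := i₀) (j := j) (hδ j) (hlb _ hx') (hkA _ hx')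
      simp only [hF]
      linarith
    have hFi : ∀ j, IntegrableOn (F j) (Metric.ball 0 R) := fun j =>
      integrableOn_ball_of_norm_le (s := β - 1) hn (by linarith)
        (hFm j).aestronglyMeasurable (hFb j)
    have hFi' : ∀ j, IntegrableOn (fun x => F j x / ‖x‖) (Metric.ball 0 R) := fun j => by
      refine integrableOn_ball_of_norm_le (C := 2 * A * C) (s := β - 2) hn (by linarith)
        ((hFm j).div measurable_norm).aestronglyMeasurable fun x hx hx0 => ?_
      have hx' : 0 < ‖x‖ := norm_pos_iff.2 hx0
      rw [norm_div, norm_norm, ← hrpow _ hx', ← mul_div_assoc]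
      exact div_le_div_of_nonneg_right (hFb j x hx hx0) hx'.le
    -- The derivatives of the flux are `O(|x|^{β-2})`, integrable since `n ≥ 2` and `β > 0`; thus
    -- the origin carries no source.
    have hDi : ∀ j, IntegrableOn (D j) (Metric.ball 0 R) := fun j => by
      refine integrableOn_ball_of_norm_le (C := 4 * (A * C)) (s := β - 2) hn (by linarith)
        (hDm j).aestronglyMeasurable fun x hx hx0 => ?_
      obtain ⟨hx', hb⟩ := hball x hx hx0
      rw [← hrpow _ hx', ← mul_div_assoc, le_div_iff₀ hx']
      have e1 : ‖ld ‖x‖ / ‖x‖ * x j * (x i₀ * x j)‖ * ‖x‖ ≤ A * k ‖x‖ := by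
        refine le_trans ?_ (hldb _ hx')
        rw [norm_mul, norm_mul, norm_mul, norm_div, norm_norm]
        calc ‖ld ‖x‖‖ / ‖x‖ * ‖x j‖ * (‖x i₀‖ * ‖x j‖) * ‖x‖
            ≤ ‖ld ‖x‖‖ / ‖x‖ * ‖x‖ * (‖x‖ * ‖x‖) * ‖x‖ := by
              gcongr
              · exact abs_coord_le x j
              · exact abs_coord_le x i₀
              · exact abs_coord_le x j
          _ = |ld ‖x‖| * ‖x‖ ^ 3 := by rw [Real.norm_eq_abs]; field_simp
      have e2 : ‖l ‖x‖ * ((if i₀ = j then x j else 0) + x i₀)‖ * ‖x‖ ≤ 2 * (A * k ‖x‖) := by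
        have h1 : ‖(if i₀ = j then x j else 0) + x i₀‖ ≤ 2 * ‖x‖ := by
          refine (norm_add_le _ _).trans ?_
          have h2 : ‖x i₀‖ ≤ ‖x‖ := abs_coord_le x i₀
          have h3 : ‖x j‖ ≤ ‖x‖ := abs_coord_le x j
          split_ifs
          · linarith
          · rw [norm_zero]; linarith
        rw [norm_mul]
        calc ‖l ‖x‖‖ * ‖(if i₀ = j then x j else 0) + x i₀‖ * ‖x‖
            ≤ ‖l ‖x‖‖ * (2 * ‖x‖) * ‖x‖ := by gcongr
          _ = 2 * (|l ‖x‖| * ‖x‖ ^ 2) := by rw [Real.norm_eq_abs]; ring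
          _ ≤ 2 * (A * k ‖x‖) := by linarith [hlb _ hx']
      have e3 : ‖(if i₀ = j then 1 else 0) * (kd ‖x‖ / ‖x‖ * x j)‖ * ‖x‖ ≤ A * k ‖x‖ := by
        refine le_trans ?_ (hkdx x hx0)
        rw [norm_mul, norm_mul]
        calc ‖(if i₀ = j then 1 else 0 : ℝ)‖ * (‖kd ‖x‖ / ‖x‖‖ * ‖x j‖) * ‖x‖
            ≤ 1 * (‖kd ‖x‖ / ‖x‖‖ * ‖x‖) * ‖x‖ := by
              gcongr
              · exact hδ j
              · exact abs_coord_le x j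
          _ = |kd ‖x‖ / ‖x‖| * ‖x‖ ^ 2 := by rw [Real.norm_eq_abs]; ring
      have e4 : ‖D j x‖ ≤ ‖ld ‖x‖ / ‖x‖ * x j * (x i₀ * x j)‖ +
          ‖l ‖x‖ * ((if i₀ = j then x j else 0) + x i₀)‖ +
          ‖(if i₀ = j then 1 else 0) * (kd ‖x‖ / ‖x‖ * x j)‖ :=
        norm_add₃_le
      have e5 := mul_le_mul_of_nonneg_right e4 hx'.le
      linarith
    have hparts : ∀ j, ∫ x in Metric.ball 0 R, F j x * pderiv j φ x =
        - ∫ x in Metric.ball 0 R, D j x * φ x := fun j =>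
      setIntegral_mul_pderiv_of_locallyLipschitzOn j
        (locallyLipschitzOn_flux hlL hkL i₀ j _) (by
          filter_upwards [ae_norm_of_ae hn hkd, ae_norm_of_ae hn hld] with x hx1 hx2 hx0
          exact hasLineDerivAt_flux hx0 (hx2 hx0) (hx1 hx0) i₀ j) (hFi' j) (hDi j) hφ
    have hφ1 : ∀ j, Continuous (pderiv j φ) := fun j =>
      (hφ.1.continuous_fderiv (by simp)).clm_apply continuous_const
    have hFφ : ∀ j, IntegrableOn (fun x => F j x * pderiv j φ x) (Metric.ball 0 R) := fun j => by
      obtain ⟨B, hB⟩ := (hφ.2.1.fderiv_apply ℝ (EuclideanSpace.single j 1)).exists_bound_of_continuous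
        (hφ1 j)
      exact (hFi j).mul_bdd (c := B) (hφ1 j).aestronglyMeasurable (Eventually.of_forall hB)
    have hDφ : ∀ j, IntegrableOn (fun x => D j x * φ x) (Metric.ball 0 R) := fun j => by
      obtain ⟨B, hB⟩ := hφ.2.1.exists_bound_of_continuous hφ.1.continuous
      exact (hDi j).mul_bdd (c := B) hφ.1.continuous.aestronglyMeasurable (Eventually.of_forall hB)
    have hga' : ∀ᵐ r : ℝ, 0 < r → r < R → a r * (1 + g r) = 1 := by
      filter_upwards [hga] with r hr h0 hR using hr ⟨h0, hR⟩
    have hae : ∫ x in Metric.ball 0 R, ∑ i, ∑ j, gsCoeff g x i j * G x i * pderiv j φ x =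
        ∫ x in Metric.ball 0 R, ∑ j, F j x * pderiv j φ x := by
      apply integral_congr_ae
      filter_upwards [ae_ne_zero_mem_ball hn R, ae_restrict_of_ae (ae_norm_of_ae hn hga')]
        with x hx hxg
      have hx' : 0 < ‖x‖ := norm_pos_iff.2 hx.1
      have hag := hxg hx.1 (mem_ball_zero_iff.1 hx.2)
      rw [Finset.sum_comm]
      refine Finset.sum_congr rfl fun j _ => ?_
      rw [← Finset.sum_mul]
      congr 1
      simp_rw [hGi]
      rw [sum_gsCoeff_mul hx.1]
      simp only [hF, hl_def, hkd_def]
      congr 2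
      field_simp
      -- The relation `a(1+g) = 1` eliminates `g` from the flux.
      linear_combination (k ‖x‖ * q ‖x‖) * hag
    have hdiv : ∀ᵐ x ∂(volume.restrict (Metric.ball (0 : Eu n) R)), ∑ j, D j x * φ x = 0 := by
      filter_upwards [ae_ne_zero_mem_ball hn R] with x hx
      have hx' : 0 < ‖x‖ := norm_pos_iff.2 hx.1
      rw [← Finset.sum_mul]
      simp only [hD]
      rw [sum_flux_divergence]
      -- Vanishing of the divergence is exactly the Riccati equation combined with `r k' = (a q - 1)
      -- k`.
      have : ld ‖x‖ / ‖x‖ * ‖x‖ ^ 2 + (n + 1) * l ‖x‖ + kd ‖x‖ / ‖x‖ = 0 := by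
        simp only [hld_def, hl_def, hkd_def, hS]
        field_simp
        ring
      rw [this, mul_zero, zero_mul]
    rw [hae, integral_finsetSum _ fun j _ => hFφ j]
    simp_rw [hparts]
    rw [Finset.sum_neg_distrib, ← integral_finsetSum _ fun j _ => hDφ j, integral_congr_ae hdiv]
    simp

end WeakSolution

/-! ### Behaviour of the solution at the origin. -/

/-- Unboundedness of the profile `k` prevents `k(|x|) x_{i₀}` from being Lipschitz at `0`. -/
lemma not_lipschitzAtZero_of_frequently {n : ℕ} (i₀ : Fin n) {k : ℝ → ℝ}
    (hk : ∀ C : ℝ, ∃ᶠ r in 𝓝[>] 0, C < k r) :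
    ¬ LipschitzAtZero (fun x : Eu n => k ‖x‖ * x i₀) := by
  rintro ⟨c, -, δ, hδ, h⟩
  have hev : ∀ᶠ r in 𝓝[>] (0 : ℝ), r ∈ Ioo 0 δ := Ioo_mem_nhdsGT hδ
  obtain ⟨r, hr, hr0, hrδ⟩ := ((hk c).and_eventually hev).exists
  have hnorm : ‖(EuclideanSpace.single i₀ r : Eu n)‖ = r := by
    rw [PiLp.norm_single, Real.norm_eq_abs, abs_of_pos hr0]
  -- On the axis `x = r e_{i₀}` the solution equals `k(r) r`, so a Lipschitz constant would bound
  -- `k`.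
  have h1 := h (EuclideanSpace.single i₀ r) (by rw [mem_ball_zero_iff, hnorm]; exact hrδ)
  simp only [PiLp.single_apply, if_true, PiLp.zero_apply, mul_zero, sub_zero] at h1
  rw [hnorm] at h1
  have h2 := le_of_mul_le_mul_right ((le_abs_self _).trans h1) hr0
  linarith

/-- Only the origin is at issue, and there `|u| ≤ C |x|^β` with `β > 0`. -/
lemma continuousOn_comp_norm_mul_coord {n : ℕ} (i₀ : Fin n) {k : ℝ → ℝ} {β C R : ℝ} (hβ : 0 < β)
    (hk0 : ∀ r, 0 < r → 0 ≤ k r) (hkL : LocallyLipschitzOn (Ioi 0) k)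
    (hkC : ∀ r ∈ Ioc 0 R, k r ≤ C * r ^ (β - 1)) :
    ContinuousOn (fun x : Eu n => k ‖x‖ * x i₀) (Metric.ball 0 R) := by
  intro x hx
  refine ContinuousAt.continuousWithinAt ?_
  by_cases hx0 : x = 0
  · subst hx0
    have hR : 0 < R := by simpa using hx
    rw [ContinuousAt]
    simp only [PiLp.zero_apply, mul_zero]
    have hlim : Tendsto (fun y : Eu n => C * ‖y‖ ^ β) (𝓝 0) (𝓝 0) := by
      have hc : Continuous fun y : Eu n => C * ‖y‖ ^ β :=
        continuous_const.mul (continuous_norm.rpow_const fun _ => Or.inr hβ.le)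
      have := hc.tendsto 0
      simpa [Real.zero_rpow hβ.ne'] using this
    refine squeeze_zero_norm' ?_ hlim
    filter_upwards [Metric.ball_mem_nhds (0 : Eu n) hR] with y hy
    by_cases hy0 : y = 0
    · simp [hy0, Real.zero_rpow hβ.ne']
    · have hy' : 0 < ‖y‖ := norm_pos_iff.2 hy0
      have h1 := hkC ‖y‖ ⟨hy', (mem_ball_zero_iff.1 hy).le⟩
      have h2 := hk0 ‖y‖ hy'
      rw [norm_mul, Real.norm_eq_abs, abs_of_nonneg h2]
      calc k ‖y‖ * ‖y i₀‖ ≤ C * ‖y‖ ^ (β - 1) * ‖y‖ :=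
            mul_le_mul h1 (PiLp.norm_apply_le y i₀) (norm_nonneg _) (h2.trans h1)
        _ = C * ‖y‖ ^ β := by
            rw [mul_assoc, ← Real.rpow_add_one hy'.ne', sub_add_cancel]
  · exact (locallyLipschitzOn_comp_norm_mul_coord hkL i₀).continuousOn.continuousAt
      (isOpen_compl_singleton.mem_nhds hx0)

/-! ### Preparation of the coefficient. -/

/-- A bounded a.e. measurable elliptic coefficient agrees a.e. with a measurable function that
obeys the same bounds everywhere. -/
lemma exists_measurable_modification {R M ε : ℝ} {g : ℝ → ℝ} (hR : 0 < R)
    (hmeas : AEMeasurable g (volume.restrict (Ioo 0 R))) (hM : ∀ r ∈ Ioo 0 R, |g r| ≤ M)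
    (hε : ∀ r ∈ Ioo 0 R, -1 + ε < g r) :
    ∃ f : ℝ → ℝ, Measurable f ∧ (∀ r, -1 + ε ≤ f r) ∧ (∀ r, f r ≤ M) ∧
      ∀ᵐ r : ℝ, r ∈ Ioo 0 R → f r = g r := by
  have hεM : -1 + ε ≤ M := by
    have h : R / 2 ∈ Ioo 0 R := ⟨by linarith, by linarith⟩
    exact ((hε _ h).le.trans (le_abs_self _)).trans (hM _ h)
  refine ⟨fun r => max (-1 + ε) (min M (hmeas.mk g r)), ?_, fun r => le_max_left _ _,
    fun r => max_le hεM (min_le_left _ _), ?_⟩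
  · exact measurable_const.max (measurable_const.min hmeas.measurable_mk)
  · have := hmeas.ae_eq_mk
    rw [Filter.EventuallyEq, ae_restrict_iff' measurableSet_Ioo] at this
    filter_upwards [this] with r hr hrR
    rw [← hr hrR, min_eq_right ((le_abs_self _).trans (hM r hrR)), max_eq_right (hε r hrR).le]

/-- The reciprocal of `1 + g` inherits bounded variation. -/
lemma boundedVariationOn_inv_one_add {g : ℝ → ℝ} {s : Set ℝ} {ε : ℝ} (hε : 0 < ε)
    (hell : ∀ r ∈ s, -1 + ε ≤ g r) (hvar : BoundedVariationOn g s) :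
    BoundedVariationOn (fun r => 1 / (1 + g r)) s := by
  have hlip : LipschitzOnWith (1 / ε ^ 2).toNNReal (fun y : ℝ => 1 / (1 + y)) (Ici (-1 + ε)) := by
    refine LipschitzOnWith.of_dist_le_mul fun x hx y hy => ?_
    rw [mem_Ici] at hx hy
    have hx1 : ε ≤ 1 + x := by linarith
    have hy1 : ε ≤ 1 + y := by linarith
    have hx0 : 0 < 1 + x := hε.trans_le hx1
    have hy0 : 0 < 1 + y := hε.trans_le hy1
    rw [Real.coe_toNNReal _ (by positivity), Real.dist_eq, Real.dist_eq]
    have : 1 / (1 + x) - 1 / (1 + y) = (y - x) / ((1 + x) * (1 + y)) := by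
      field_simp
      ring
    rw [this, abs_div, abs_of_pos (mul_pos hx0 hy0), abs_sub_comm, one_div, inv_mul_eq_div]
    refine div_le_div_of_nonneg_left (abs_nonneg _) (by positivity) ?_
    rw [pow_two]
    exact mul_le_mul hx1 hy1 hε.le hx0.le
  exact hlip.comp_boundedVariationOn (fun r hr => hell r hr) hvar

/-- Comparison of `g / (1 + g)` with `g` up to a Dini-integrable error. -/
lemma exists_comparison {g : ℝ → ℝ} {M ε : ℝ} (hM : ∀ r ∈ Ioo (0 : ℝ) (1 / 2), |g r| ≤ M)
    (hε : 0 < ε) (hell : ∀ r ∈ Ioo (0 : ℝ) (1 / 2), -1 + ε ≤ g r)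
    (hg : SquareDiniAtZero g ∨ ∃ ε > 0, ∀ r ∈ Ioo 0 ε, 0 < g r) :
    ∃ c > 0, ∃ h : ℝ → ℝ, IntegrableOn h (Ioo 0 (1 / 2)) ∧ ∀ r ∈ Ioo (0 : ℝ) (1 / 2),
      c * (g r / r) - h r ≤ (1 - 1 / (1 + g r)) / r := by
  have hM0 : 0 ≤ M := (abs_nonneg _).trans (hM (1 / 4) (by constructor <;> norm_num))
  have hpos : ∀ r ∈ Ioo (0 : ℝ) (1 / 2), 0 < 1 + g r := fun r hr => by linarith [hell r hr]
  have hid : ∀ r ∈ Ioo (0 : ℝ) (1 / 2), (1 - 1 / (1 + g r)) / r = g r / r / (1 + g r) := by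
    intro r hr
    have := (hpos r hr).ne'
    have := hr.1.ne'
    field_simp
    ring
  have hconst : ∀ B δ : ℝ, IntegrableOn ((Ici δ).indicator fun _ : ℝ => B) (Ioo 0 (1 / 2)) :=
    fun B δ => Integrable.indicator (integrableOn_const (by simp)) measurableSet_Ici
  rcases hg with ⟨w, -, -, -, hwi, hgw⟩ | ⟨δ, hδ, hgδ⟩
  · obtain ⟨δ, hδ, hgδ⟩ := mem_nhdsGT_iff_exists_Ioo_subset.1 hgw
    rw [mem_Ioi] at hδ
    -- Here `g - g/(1+g) = g²/(1+g) ≤ g²/ε`, which the square-Dini modulus controls on `(0, δ)`. The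
    -- indicator pays for `r ≥ δ`, where everything is bounded.
    refine ⟨1, one_pos, (fun r => 1 / ε * (w r ^ 2 / r)) +
      (Ici δ).indicator (fun _ => M ^ 2 / ε / δ), (hwi.const_mul (1 / ε)).add (hconst (M ^ 2 / ε / δ) δ), ?_⟩
    intro r hr
    simp only [Pi.add_apply]
    have hr0 := hr.1
    have hp := hpos r hr
    have hsq : g r / r - g r / r / (1 + g r) ≤ g r ^ 2 / ε / r := by
      have h1 : g r / r - g r / r / (1 + g r) = g r ^ 2 / (1 + g r) / r := by
        field_simp
        ring
      rw [h1]
      have h2 : ε ≤ 1 + g r := by linarith [hell r hr]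
      gcongr
    rw [hid r hr, one_mul]
    have hw0 : 0 ≤ 1 / ε * (w r ^ 2 / r) := by positivity
    rcases lt_or_ge r δ with h | h
    · rw [indicator_of_notMem (by simpa using h)]
      have h3 : |g r| ≤ w r := hgδ ⟨hr0, h⟩
      have h4 : g r ^ 2 / ε / r ≤ 1 / ε * (w r ^ 2 / r) := by
        have : g r ^ 2 ≤ w r ^ 2 := by
          rw [← sq_abs]; exact pow_le_pow_left₀ (abs_nonneg _) h3 2
        calc g r ^ 2 / ε / r ≤ w r ^ 2 / ε / r := by gcongr
          _ = _ := by field_simp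
      linarith
    · rw [indicator_of_mem (show r ∈ Ici δ from h)]
      have h4 : g r ^ 2 / ε / r ≤ M ^ 2 / ε / δ := by
        have : g r ^ 2 ≤ M ^ 2 := by
          rw [← sq_abs]; exact pow_le_pow_left₀ (abs_nonneg _) (hM r hr) 2
        gcongr
      linarith
  -- For `g > 0`, simply `g/(1+g) ≥ g/(1+M)`; an error is needed only on `r ≥ δ`.
  · refine ⟨1 / (1 + M), by positivity, (Ici δ).indicator (fun _ => M / δ + M / δ / ε),
      hconst _ _, ?_⟩
    intro r hr
    have hr0 := hr.1
    have hp := hpos r hr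
    rw [hid r hr]
    rcases lt_or_ge r δ with h | h
    · rw [indicator_of_notMem (by simpa using h), sub_zero]
      have hg0 := hgδ r ⟨hr0, h⟩
      have h1 : 1 + g r ≤ 1 + M := by linarith [(le_abs_self _).trans (hM r hr)]
      rw [one_div_mul_eq_div]
      exact div_le_div_of_nonneg_left (by positivity) hp h1
    · rw [indicator_of_mem (show r ∈ Ici δ from h)]
      have h1 : |g r / r| ≤ M / δ := by
        rw [abs_div, abs_of_pos hr0]
        exact div_le_div₀ hM0 (hM r hr) hδ h
      have h2 : |g r / r / (1 + g r)| ≤ M / δ / ε := by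
        rw [abs_div, abs_of_pos hp]
        exact div_le_div₀ (by positivity) h1 hε (by linarith [hell r hr])
      have h3 : 1 / (1 + M) * (g r / r) ≤ M / δ := by
        have h4 : |1 / (1 + M) * (g r / r)| ≤ M / δ := by
          rw [abs_mul, abs_of_pos (by positivity : 0 < 1 / (1 + M))]
          exact (mul_le_of_le_one_left (abs_nonneg _)
            ((div_le_one (by positivity)).2 (by linarith))).trans h1
        exact (le_abs_self _).trans h4
      linarith [neg_abs_le (g r / r / (1 + g r))]

/-! ### Assembly. -/

theorem proposition3 (n : ℕ) (hn : 2 ≤ n) (R : ℝ) (hR : 1 / 2 ≤ R) (g : ℝ → ℝ)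
    -- `g` is measurable and bounded on `(0, R)`, with `g > -1 + ε` (uniform ellipticity)
    (hmeas : AEMeasurable g (volume.restrict (Ioo 0 R)))
    (hbdd : ∃ M : ℝ, ∀ r ∈ Ioo 0 R, |g r| ≤ M)
    (hell : ∃ ε > 0, ∀ r ∈ Ioo 0 R, -1 + ε < g r)
    -- `g` has finite total variation on `(0, 1/2)`
    (hvar : BoundedVariationOn g (Ioo 0 (1 / 2)))
    -- `limsup_{r → 0} ∫_r^{1/2} g(s) / s ds = +∞`
    (hlim : limsup (fun r : ℝ => ((∫ s in r..(1 / 2), g s / s : ℝ) : EReal)) (𝓝[>] 0) = ⊤)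
    -- `g` is square-Dini continuous at `0`, or `g > 0` near `0`
    (hg : SquareDiniAtZero g ∨ ∃ ε > 0, ∀ r ∈ Ioo 0 ε, 0 < g r) :
    ∃ (v : ℝ → ℝ) (Θ : Eu n → ℝ) (u : Eu n → ℝ),
      IsSphereEigenfunction ((n : ℝ) - 1) Θ ∧ v 0 = 0 ∧
      (∀ x, u x = v ‖x‖ * Θ (‖x‖⁻¹ • x)) ∧
      ContinuousOn u (Metric.ball 0 R) ∧
      IsWeakSolution (gsCoeff g) (Metric.ball 0 R) u ∧
      ¬ LipschitzAtZero u := by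
  obtain ⟨M, hM⟩ := hbdd
  obtain ⟨ε, hε, hell⟩ := hell
  have hR0 : 0 < R := by linarith
  have hsub : Ioo (0 : ℝ) (1 / 2) ⊆ Ioo 0 R := Ioo_subset_Ioo_right hR
  have hn1 : (1 : ℝ) ≤ (n : ℝ) - 1 := by
    have : (2 : ℝ) ≤ n := by exact_mod_cast hn
    linarith
  -- The Riccati construction needs a measurable coefficient with bounds on the whole line. Bounded
  -- variation need not survive a change on a null set, so it is taken from `g` itself.
  obtain ⟨f, hf, hfl, hfu, hfg⟩ := exists_measurable_modification hR0 hmeas hM hell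
  have hM1 : 0 < 1 + M := by linarith [(hfl 0).trans (hfu 0)]
  set a : ℝ → ℝ := fun r => 1 / (1 + f r) with ha_def
  have ha : Measurable a := by simp only [ha_def]; fun_prop
  have hf0 : ∀ r, 0 < 1 + f r := fun r => by linarith [hfl r]
  have hal : ∀ r, 1 / (1 + M) ≤ a r := fun r =>
    one_div_le_one_div_of_le (hf0 r) (by linarith [hfu r])
  have hau : ∀ r, a r ≤ 1 / ε := fun r => one_div_le_one_div_of_le hε (by linarith [hfl r])
  have ha₀ : 0 < 1 / (1 + M) := by positivity
  obtain ⟨q, m, Q, hm, hq, hqm, hqM, hqL, hqd⟩ :=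
    exists_riccati_solution_hasDerivAt hn1 ha₀ ha hal hau
  obtain ⟨k, β, hβ, hk, hkL, hke, hkd, hkb⟩ :=
    exists_radial_profile ha₀ ha hal hau hm hq hqm hqM
  obtain ⟨C, hkC⟩ := hkb R
  have hk0 : ∀ r, 0 < r → 0 ≤ k r := fun r hr => by rw [hke r hr]; positivity
  have hlim' : ∀ C : ℝ, ∃ᶠ r in 𝓝[>] (0 : ℝ), C < ∫ s in r..(1 / 2), g s / s := by
    intro C
    have := frequently_lt_of_lt_limsup (by isBoundedDefault)
      (hlim ▸ EReal.coe_lt_top C : (C : EReal) < limsup (fun r : ℝ =>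
        ((∫ s in r..(1 / 2), g s / s : ℝ) : EReal)) (𝓝[>] 0))
    exact this.mono fun r hr => EReal.coe_lt_coe_iff.1 hr
  obtain ⟨c, hc, h, hh, hgh⟩ := exists_comparison (fun r hr => hM r (hsub hr)) hε
    (fun r hr => (hell r (hsub hr)).le) hg
  have hfg' : ∀ᵐ r : ℝ, r ∈ Ioo (0 : ℝ) (1 / 2) → f r = g r :=
    hfg.mono fun r hr hr' => hr (hsub hr')
  have hgi : ∀ r : ℝ, 0 < r → r < 1 / 2 →
      IntervalIntegrable (fun ρ => g ρ / ρ) volume r (1 / 2) := by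
    intro r hr hr2
    rw [intervalIntegrable_iff_integrableOn_Ioo_of_le hr2.le]
    have hs : Ioo r (1 / 2) ⊆ Ioo 0 R := (Ioo_subset_Ioo_left hr.le).trans hsub
    refine Integrable.mono' (g := fun _ => M / r) (integrableOn_const (by simp))
      ((hmeas.mono_measure (Measure.restrict_mono hs le_rfl)).div
        measurable_id.aemeasurable).aestronglyMeasurable ?_
    filter_upwards [ae_restrict_mem measurableSet_Ioo] with ρ hρ
    rw [norm_div, Real.norm_eq_abs, Real.norm_eq_abs, abs_of_pos (hr.trans hρ.1)]
    exact div_le_div₀ ((abs_nonneg _).trans (hM ρ (hs hρ))) (hM ρ (hs hρ)) hr hρ.1.le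
  have hfreq := frequently_lt_integral_profile hn1 ha₀ ha hal hau hm hq hqm hqM hqL hqd
    (boundedVariationOn_inv_one_add hε (fun r hr => (hell r (hsub hr)).le) hvar)
    (hfg'.mono fun r hr hr' => by simp only [ha_def]; rw [hr hr']) hc hh hgi
    (hfg'.mono fun r hr hr' => by simp only [ha_def]; rw [hr hr']; exact hgh r hr') hlim'
  let i₀ : Fin n := ⟨0, by omega⟩
  refine ⟨fun r => k r * r, fun x => x i₀, fun x => k ‖x‖ * x i₀, isSphereEigenfunction_coord i₀,
    by simp, fun x => ?_, continuousOn_comp_norm_mul_coord i₀ hβ hk0 hkL hkC, ?_, ?_⟩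
  · by_cases hx : x = 0
    · simp [hx]
    · have : ‖x‖ ≠ 0 := norm_ne_zero_iff.2 hx
      simp only [PiLp.smul_apply, smul_eq_mul]
      field_simp
  · refine isWeakSolution_radial hn i₀ ha₀ ha hal hau hm hq hqm hqM hqL hqd hβ hk hk0 hkL hkd hkC
      (hfg.mono fun r hr hrR => ?_)
    rw [← hr hrR]
    exact one_div_mul_cancel (hf0 r).ne'
  · refine not_lipschitzAtZero_of_frequently i₀ fun C => ?_
    refine ((hfreq C).and_eventually self_mem_nhdsWithin).mono fun r hr => ?_
    rw [hke r hr.2]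
    -- Since `exp x ≥ x + 1`, unboundedness of `log k` passes to `k`.
    linarith [hr.1, Real.add_one_le_exp (∫ ρ in (1 : ℝ)..r, (a ρ * q ρ - 1) / ρ)]
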